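/- Let $\mathbb{X}$ be a semi-additive category, i.e. a category with finite biproducts (written $\times$, with projections $\pi_j$; hom-sets are then canonically commutative monoids), and let $(\mathsf{S},\mu,\eta,\partial)$ be a coCartesian differential monad on $\mathbb{X}$: a monad $(\mathsf S,\mu,\eta)$ with a natural transformation $\partial_A:\mathsf S(A)\to\mathsf S(A\times A)$ satisfying (1) $\mathsf S(\pi_1)\circ\partial_A=0$; (2) $\mathsf S(\langle\pi_1,\pi_2,\pi_2\rangle)\circ\partial_A=\mathsf S(\langle\pi_1,\pi_2,0\rangle)\circ\partial_A+\mathsf S(\langle\pi_1,0,\pi_2\rangle)\circ\partial_A$; (3) $\partial_A\circ\eta_A=\eta_{A\times A}\circ\langle 0,1_A\rangle$; (4) $\partial_A\circ\mu_A=\mu_{A\times A}\circ\mathsf S(\mathsf S(\langle 1_A,0\rangle)\circ\pi_1+\partial_A\circ\pi_2)\circ\partial_{\mathsf S(A)}$; (5) $\mathsf S(\langle\pi_1,\pi_4\rangle)\circ\partial_{A\times A}\circ\partial_A=\partial_A$; (6) $\mathsf S(\langle\pi_1,\pi_3,\pi_2,\pi_4\rangle)\circ\partial_{A\times A}\circ\partial_A=\partial_{A\times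 A}\circ\partial_A$. Let $\mathsf{ALG}_{\mathsf S}$ be the category of $\mathsf S$-algebras, $\mathsf F^{\mathsf S}:\mathbb X\to\mathsf{ALG}_{\mathsf S}$, $\mathsf F^{\mathsf S}(A)=(\mathsf S(A),\mu_A)$, the free algebra functor, and $\lambda_A=\langle\mathsf S(\pi_1),\mathsf S(\pi_1+\pi_4)\circ\partial_{A\times A}\rangle:\mathsf S(A\times A)\to\mathsf S(A)\times\mathsf S(A)$. Let $\mathbb T=(\mathsf T,p,s,z,l,c)$ be the following data on $\mathsf{ALG}_{\mathsf S}$: $\mathsf T(A,\alpha)=(A\times A,(\alpha\times\alpha)\circ\lambda_A)$, $\mathsf T(f)=f\times f$, $p=\pi_1$, with $n$-fold pullback $\mathsf T_n(A,\alpha)$ of $p$ carried by $A^{n+1}$ with projections $q_j=\langle\pi_1,\pi_{j+1}\rangle$ to $\mathsf T(A,\alpha)$, $s=\langle\pi_1,\pi_2+\pi_3\rangle:\mathsf T_2\to\mathsf T$, $z=\langle 1,0\rangle$, $l=\langle\pi_1,0,0,\pi_2\rangle$, $c=\langle\pi_1,\pi_3,\pi_2,\pi_4\rangle$. Let $\mathbb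 B^\circ$ be the following data on $\mathbb X^{op}$, described by maps of $\mathbb X$: $\mathsf B(A)=A\times A$, $p^{\times\circ}=\langle 1,0\rangle$, $n$-fold pushouts $\mathsf B_n(A)=A^{n+1}$ with injections $\langle\pi_1,0,\dots,0,\pi_2,0,\dots,0\rangle:A\times A\to A^{n+1}$ ($\pi_2$ in position $j+1$), $s^{\times\circ}=\langle\pi_1,\pi_2,\pi_2\rangle$, $z^{\times\circ}=\pi_1$, $l^{\times\circ}=\langle\pi_1,\pi_4\rangle$, $c^{\times\circ}=\langle\pi_1,\pi_3,\pi_2,\pi_4\rangle$. If $\mathbb X$ is additive (all hom-sets are abelian groups), the negative map on each side is $\langle\pi_1,-\pi_2\rangle$. Tangent structures are taken in the sense of Cockett and Cruttwell; they are Rosický if there is moreover a compatible negative map, and a tangent category is Cartesian if it has finite products and its tangent bundle functor preserves them. A tangent category has adjoint tangent structure if every $\mathsf T_n$ has a left adjoint $\mathsf T^\circ_n$ (with $\mathsf T^\circ\dashv\mathsf T$ for $n=1$); then $\mathbb T^\circ=(\mathsf T^\circ,p^\circ,s^\circ,z^\circ,l^\circ,c^\circ)$ (and $n^\circ$) denotes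 the data on the opposite category whose structure maps are the mates of those of $\mathbb T$. A tangent morphism $(\mathsf F,\alpha)$ is a functor with a natural transformation $\alpha:\mathsf F\mathsf T\to\mathsf T'\mathsf F$ compatible with all structure maps (including the negatives in the Rosický case); it is strong if $\alpha$ is an isomorphism and $\mathsf F$ preserves the $n$-fold pullbacks of $p$ and the equalizers in the universality of the vertical lift, and it is Cartesian if moreover $\mathsf F$ preserves finite products. **Theorem.** Suppose that $\mathsf{ALG}_{\mathsf S}$ has all reflexive coequalizers. Then $(\mathsf{ALG}_{\mathsf S},\mathbb T)$ is a tangent category with adjoint tangent structure. For any choice of the left adjoints, $(\mathsf{ALG}_{\mathsf S}^{op},\mathbb T^\circ)$ is a tangent category, and there is a natural isomorphism $\tau_A:\mathsf T^\circ(\mathsf S(A),\mu_A)\to(\mathsf S(A\times A),\mu_{A\times A})$, given by $$\tau_A=\varepsilon_{\mathsf F^{\mathsf S}(A\times A)}\circ\mathsf T^\circ(\lambda_{A\times A})\circ\mathsf T^\circ(\mathsf S(\langle 1_A,0,0,1_A\rangle))$$ with $\varepsilon$ the counit of $\mathsf T^\circ\dashv\mathsf T$, such that $(\mathsf F^{\mathsf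 S},\tau):(\mathbb X^{op},\mathbb B^\circ)\to(\mathsf{ALG}_{\mathsf S}^{op},\mathbb T^\circ)$ is a strong tangent morphism of tangent categories. If $\mathbb X$ is additive, then $(\mathsf{ALG}_{\mathsf S},\mathbb T)$ and $(\mathsf{ALG}_{\mathsf S}^{op},\mathbb T^\circ)$ are Rosický tangent categories and $(\mathsf F^{\mathsf S},\tau)$ is a strong Rosický tangent morphism. If $\mathsf{ALG}_{\mathsf S}$ also has finite coproducts, then $(\mathsf{ALG}_{\mathsf S}^{op},\mathbb T^\circ)$ is a Cartesian (and, if $\mathbb X$ is additive, Cartesian Rosický) tangent category, and $(\mathsf F^{\mathsf S},\tau)$ is a strong Cartesian (Rosický) tangent morphism. -/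

import Mathlib

open CategoryTheory CategoryTheory.Limits

universe v u

noncomputable section

/-! ## Tangent categories -/

namespace TangentCat

variable {C : Type u} [Category.{v} C]

/-- The commuting cone `(b, q₀, …, qₙ₋₁)` with vertex `P` exhibits `P` as the `n`-fold pullback of
`n` copies of `p : E ⟶ A`. -/
def IsNFoldPullback {n : ℕ} {E A P : C} (p : E ⟶ A) (b : P ⟶ A) (q : Fin n → (P ⟶ E)) : Prop :=
  ∃ w : ∀ j, q j ≫ p = b,
    Nonempty (IsLimit (WidePullbackShape.mkCone
      (F := WidePullbackShape.wideCospan A (fun _ : Fin n => E) (fun _ => p)) b q w))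

/-- `i : P ⟶ Y` is an equalizer of `f, g : Y ⟶ Z`. -/
def IsEqualizer {P Y Z : C} (i : P ⟶ Y) (f g : Y ⟶ Z) : Prop :=
  ∃ w : i ≫ f = i ≫ g, Nonempty (IsLimit (Fork.ofι i w))

/-- The powers `F^m` of an endofunctor. -/
def iter (F : C ⥤ C) : ℕ → (C ⥤ C)
  | 0 => 𝟭 C
  | m + 1 => iter F m ⋙ F

end TangentCat

open TangentCat

/-- The data of a tangent structure `(T, p, s, z, l, c)`, including functors `Tₙ` with projections
`qⱼ : Tₙ ⟶ T` and `b : Tₙ ⟶ 𝟭` (the common composite `qⱼ ≫ p`), which the axioms `IsTangent` below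
require to be the `n`-fold pullbacks of `p`. -/
structure TangentData (C : Type u) [Category.{v} C] where
  /-- tangent bundle functor -/
  T : C ⥤ C
  /-- projection -/
  p : T ⟶ 𝟭 C
  /-- the `n`-fold pullbacks of the projection -/
  Tn : ℕ → (C ⥤ C)
  /-- projection of the `n`-fold pullback to the base -/
  b : ∀ n, Tn n ⟶ 𝟭 C
  /-- pullback projections -/
  q : ∀ n, Fin n → (Tn n ⟶ T)
  /-- sum -/
  s : Tn 2 ⟶ T
  /-- zero -/
  z : 𝟭 C ⟶ T
  /-- vertical lift -/
  l : T ⟶ T ⋙ T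
  /-- canonical flip -/
  c : T ⋙ T ⟶ T ⋙ T

namespace TangentData

variable {C : Type u} [Category.{v} C] (D : TangentData C)

/-- `k = s ∘ ⟨f, g⟩` for generalized elements `f, g` of `T A`
(so that `f` and `g` lie in the same fibre of `p`). -/
def IsSum {Y A : C} (f g k : Y ⟶ D.T.obj A) : Prop :=
  ∃ u : Y ⟶ (D.Tn 2).obj A,
    u ≫ (D.q 2 0).app A = f ∧ u ≫ (D.q 2 1).app A = g ∧ u ≫ D.s.app A = k

/-- `w = T(s) ∘ ⟨l ∘ q₀, z_T ∘ q₁⟩ : T₂ A ⟶ T² A`, the pairing being taken in `T (T₂ A)`. -/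
def IsVertical (A : C) (w : (D.Tn 2).obj A ⟶ D.T.obj (D.T.obj A)) : Prop :=
  ∃ u : (D.Tn 2).obj A ⟶ D.T.obj ((D.Tn 2).obj A),
    u ≫ D.T.map ((D.q 2 0).app A) = (D.q 2 0).app A ≫ D.l.app A ∧
    u ≫ D.T.map ((D.q 2 1).app A) = (D.q 2 1).app A ≫ D.z.app (D.T.obj A) ∧
    w = u ≫ D.T.map (D.s.app A)

/-- The axioms of a tangent structure in the sense of Cockett and Cruttwell. -/
structure IsTangent : Prop where
  /-- `Tₙ A` is the `n`-fold pullback of `p_A`, and all powers of `T` preserve it. -/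
  isPullback : ∀ (m n : ℕ) (A : C), IsNFoldPullback ((iter D.T m).map (D.p.app A))
    ((iter D.T m).map ((D.b n).app A)) (fun j => (iter D.T m).map ((D.q n j).app A))
  -- `(p, s, z)` is a commutative monoid over each object `A`
  s_p : ∀ A, D.s.app A ≫ D.p.app A = (D.b 2).app A
  z_p : ∀ A, D.z.app A ≫ D.p.app A = 𝟙 A
  sum_assoc : ∀ {Y A : C} {f g h a e r : Y ⟶ D.T.obj A},
    D.IsSum f g a → D.IsSum a h r → D.IsSum g h e → D.IsSum f e r
  sum_comm : ∀ {Y A : C} {f g r : Y ⟶ D.T.obj A}, D.IsSum f g r → D.IsSum g f r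
  sum_zero : ∀ {Y A : C} (f : Y ⟶ D.T.obj A), D.IsSum f (f ≫ D.p.app A ≫ D.z.app A) f
  -- `(l, z)` is an additive bundle morphism from `p_A` to `T(p_A)`
  l_p : ∀ A, D.l.app A ≫ D.T.map (D.p.app A) = D.p.app A ≫ D.z.app A
  z_l : ∀ A, D.z.app A ≫ D.l.app A = D.z.app A ≫ D.T.map (D.z.app A)
  s_l : ∀ A, ∃ u : (D.Tn 2).obj A ⟶ D.T.obj ((D.Tn 2).obj A),
    (∀ j, u ≫ D.T.map ((D.q 2 j).app A) = (D.q 2 j).app A ≫ D.l.app A) ∧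
    D.s.app A ≫ D.l.app A = u ≫ D.T.map (D.s.app A)
  -- `(c, 1)` is an additive bundle morphism from `T(p_A)` to `p_{T A}`
  c_p : ∀ A, D.c.app A ≫ D.p.app (D.T.obj A) = D.T.map (D.p.app A)
  z_c : ∀ A, D.T.map (D.z.app A) ≫ D.c.app A = D.z.app (D.T.obj A)
  s_c : ∀ A, D.IsSum (A := D.T.obj A) (D.T.map ((D.q 2 0).app A) ≫ D.c.app A)
    (D.T.map ((D.q 2 1).app A) ≫ D.c.app A) (D.T.map (D.s.app A) ≫ D.c.app A)
  -- coherence of the vertical lift and the canonical flip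
  c_c : ∀ A, D.c.app A ≫ D.c.app A = 𝟙 _
  l_c : ∀ A, D.l.app A ≫ D.c.app A = D.l.app A
  l_l : ∀ A, D.l.app A ≫ D.T.map (D.l.app A) = D.l.app A ≫ D.l.app (D.T.obj A)
  c_c_c : ∀ A, D.T.map (D.c.app A) ≫ D.c.app (D.T.obj A) ≫ D.T.map (D.c.app A) =
    D.c.app (D.T.obj A) ≫ D.T.map (D.c.app A) ≫ D.c.app (D.T.obj A)
  l_c_c : ∀ A, D.l.app (D.T.obj A) ≫ D.T.map (D.c.app A) ≫ D.c.app (D.T.obj A) =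
    D.c.app A ≫ D.T.map (D.l.app A)
  /-- Universality of the vertical lift (preserved by all powers of `T`). -/
  universal : ∀ A, ∃ w, D.IsVertical A w ∧ ∀ m : ℕ, IsEqualizer ((iter D.T m).map w)
    ((iter D.T m).map (D.T.map (D.p.app A)))
    ((iter D.T m).map (D.T.map (D.p.app A) ≫ D.p.app A ≫ D.z.app A))

/-- The tangent structure together with the negative map `ν` is a Rosický tangent structure. -/
structure IsRosicky (ν : D.T ⟶ D.T) : Prop where
  isTangent : D.IsTangent
  n_p : ∀ A, ν.app A ≫ D.p.app A = D.p.app A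
  n_sum : ∀ A, D.IsSum (𝟙 (D.T.obj A)) (ν.app A) (D.p.app A ≫ D.z.app A)

/-- Cartesian tangent categories: there are finite products, and `T` preserves them
(i.e. the canonical comparison maps are isomorphisms). -/
structure IsCartesian : Prop where
  isTangent : D.IsTangent
  hasFiniteProducts : HasFiniteProducts C
  preservesFiniteProducts : PreservesFiniteProducts D.T

/-- A tangent category has adjoint tangent structure if all the functors `Tₙ` (in particular
`T ≅ T₁`) are right adjoints. -/
structure HasAdjointTangentStructure : Prop where
  isTangent : D.IsTangent
  isRightAdjoint : D.T.IsRightAdjoint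
  isRightAdjoint_n : ∀ n, (D.Tn n).IsRightAdjoint

/-- The data of a tangent structure on `Cᵒᵖ`, from structure maps on `C` in the reversed
direction. -/
def ofDual (T : C ⥤ C) (p : 𝟭 C ⟶ T) (Tn : ℕ → (C ⥤ C)) (b : ∀ n, 𝟭 C ⟶ Tn n)
    (q : ∀ n, Fin n → (T ⟶ Tn n)) (s : T ⟶ Tn 2) (z : T ⟶ 𝟭 C) (l : T ⋙ T ⟶ T)
    (c : T ⋙ T ⟶ T ⋙ T) : TangentData Cᵒᵖ where
  T := T.op
  p :=
    { app := fun A => (p.app A.unop).op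
      naturality := fun _ _ f => Quiver.Hom.unop_inj (p.naturality f.unop).symm }
  Tn n := (Tn n).op
  b n :=
    { app := fun A => ((b n).app A.unop).op
      naturality := fun _ _ f => Quiver.Hom.unop_inj ((b n).naturality f.unop).symm }
  q n j := NatTrans.op (q n j)
  s := NatTrans.op s
  z :=
    { app := fun A => (z.app A.unop).op
      naturality := fun _ _ f => Quiver.Hom.unop_inj (z.naturality f.unop).symm }
  l :=
    { app := fun A => (l.app A.unop).op
      naturality := fun _ _ f => Quiver.Hom.unop_inj (l.naturality f.unop).symm }
  c :=
    { app := fun A => (c.app A.unop).op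
      naturality := fun _ _ f => Quiver.Hom.unop_inj (c.naturality f.unop).symm }

/-- A choice of left adjoints `T° ⊣ T` and `Tₙ° ⊣ Tₙ`. -/
structure Adjoints where
  L : C ⥤ C
  adj : L ⊣ D.T
  Ln : ℕ → (C ⥤ C)
  adjn : ∀ n, Ln n ⊣ D.Tn n

/-- The adjoint tangent structure `T°` on the opposite category. Each structure map is the mate
of the corresponding structure map of `T`: for `α : R₁ ⟶ R₂` and `Lᵢ ⊣ Rᵢ` this is
`α° = (L₂ --L₂(η₁)--> L₂ R₁ L₁ --L₂(α)--> L₂ R₂ L₁ --ε₂--> L₁)`. -/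
def dual (E : D.Adjoints) : TangentData Cᵒᵖ :=
  ofDual E.L
    ((conjugateEquiv E.adj Adjunction.id).symm D.p)
    E.Ln
    (fun n => (conjugateEquiv (E.adjn n) Adjunction.id).symm (D.b n))
    (fun n j => (conjugateEquiv (E.adjn n) E.adj).symm (D.q n j))
    ((conjugateEquiv (E.adjn 2) E.adj).symm D.s)
    ((conjugateEquiv Adjunction.id E.adj).symm D.z)
    ((conjugateEquiv E.adj (E.adj.comp E.adj)).symm D.l)
    ((conjugateEquiv (E.adj.comp E.adj) (E.adj.comp E.adj)).symm D.c)

/-- The adjoint negative map. -/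
def dualNeg (E : D.Adjoints) (ν : D.T ⟶ D.T) : (D.dual E).T ⟶ (D.dual E).T :=
  NatTrans.op ((conjugateEquiv E.adj E.adj).symm ν)

end TangentData

section Morphisms

universe v' u'

variable {C : Type u} [Category.{v} C] {C' : Type u'} [Category.{v'} C']

/-- `(F, α)` is a tangent morphism from `(C, D)` to `(C', D')`, where `α : F T ⟶ T' F`. -/
structure IsTangentMorphism (D : TangentData C) (D' : TangentData C') (F : C ⥤ C')
    (α : D.T ⋙ F ⟶ F ⋙ D'.T) : Prop where
  source : D.IsTangent
  target : D'.IsTangent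
  p : ∀ A, α.app A ≫ D'.p.app (F.obj A) = F.map (D.p.app A)
  z : ∀ A, F.map (D.z.app A) ≫ α.app A = D'.z.app (F.obj A)
  s : ∀ A, D'.IsSum (A := F.obj A) (F.map ((D.q 2 0).app A) ≫ α.app A)
    (F.map ((D.q 2 1).app A) ≫ α.app A) (F.map (D.s.app A) ≫ α.app A)
  l : ∀ A, α.app A ≫ D'.l.app (F.obj A) =
    F.map (D.l.app A) ≫ α.app (D.T.obj A) ≫ D'.T.map (α.app A)
  c : ∀ A, α.app (D.T.obj A) ≫ D'.T.map (α.app A) ≫ D'.c.app (F.obj A) =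
    F.map (D.c.app A) ≫ α.app (D.T.obj A) ≫ D'.T.map (α.app A)

/-- A tangent morphism `(F, α)` is strong if `α` is an isomorphism and `F` preserves the `n`-fold
pullbacks of the projection and the equalizers of the vertical lift. -/
structure IsStrongTangentMorphism (D : TangentData C) (D' : TangentData C') (F : C ⥤ C')
    (α : D.T ⋙ F ⟶ F ⋙ D'.T) : Prop extends IsTangentMorphism D D' F α where
  isIso : IsIso α
  pullback : ∀ (n : ℕ) (A : C), IsNFoldPullback (F.map (D.p.app A)) (F.map ((D.b n).app A))
    (fun j => F.map ((D.q n j).app A))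
  equalizer : ∀ A, ∃ w, D.IsVertical A w ∧ IsEqualizer (F.map w)
    (F.map (D.T.map (D.p.app A))) (F.map (D.T.map (D.p.app A) ≫ D.p.app A ≫ D.z.app A))

/-- Strong tangent morphisms of Rosický tangent categories: those compatible with the negatives. -/
structure IsStrongRosickyTangentMorphism (D : TangentData C) (ν : D.T ⟶ D.T)
    (D' : TangentData C') (ν' : D'.T ⟶ D'.T) (F : C ⥤ C') (α : D.T ⋙ F ⟶ F ⋙ D'.T) : Prop
    extends IsStrongTangentMorphism D D' F α where
  source_neg : D.IsRosicky ν
  target_neg : D'.IsRosicky ν'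
  n : ∀ A, F.map (ν.app A) ≫ α.app A = α.app A ≫ ν'.app (F.obj A)

/-- Strong tangent morphisms of Cartesian tangent categories: those preserving finite products. -/
structure IsStrongCartesianTangentMorphism (D : TangentData C) (D' : TangentData C') (F : C ⥤ C')
    (α : D.T ⋙ F ⟶ F ⋙ D'.T) : Prop extends IsStrongTangentMorphism D D' F α where
  source_cartesian : D.IsCartesian
  target_cartesian : D'.IsCartesian
  preservesFiniteProducts : PreservesFiniteProducts F

end Morphisms

/-! ## Semi-additive categories and coCartesian differential monads

A semi-additive category is a category with finite biproducts; its hom-sets carry a canonical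
addition, for which composition is bilinear. -/

namespace CoCartesianDiff

attribute [local instance] hasBinaryBiproducts_of_finite_biproducts
  CategoryTheory.SemiadditiveOfBinaryBiproducts.addCommMonoidHomOfHasBinaryBiproducts

open CategoryTheory.SemiadditiveOfBinaryBiproducts

variable (X : Type u) [Category.{v} X] [HasZeroMorphisms X] [HasFiniteBiproducts X]

/-- A semi-additive category is additive if each commutative monoid of morphisms is a group. -/
class IsAdditive : Prop where
  exists_neg : ∀ {A B : X} (f : A ⟶ B), ∃ g : A ⟶ B, f + g = 0

variable {X}

/-- The negative of a morphism in an additive category. -/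
def negHom [IsAdditive X] {A B : X} (f : A ⟶ B) : A ⟶ B :=
  Classical.choose (IsAdditive.exists_neg f)

theorem add_negHom [IsAdditive X] {A B : X} (f : A ⟶ B) : f + negHom f = 0 :=
  Classical.choose_spec (IsAdditive.exists_neg f)

/-- The sum of `π₁` and `π₄`, the first and the last of four projections. -/
def ends (A : X) : (A ⊞ A) ⊞ (A ⊞ A) ⟶ A :=
  biprod.fst ≫ biprod.fst + biprod.snd ≫ biprod.snd

/-- The map `⟨π₁, π₄⟩`. -/
def outer (A : X) : (A ⊞ A) ⊞ (A ⊞ A) ⟶ A ⊞ A :=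
  biprod.lift (biprod.fst ≫ biprod.fst) (biprod.snd ≫ biprod.snd)

/-- The map `⟨π₁, π₃, π₂, π₄⟩`. -/
def flipB (A : X) : (A ⊞ A) ⊞ (A ⊞ A) ⟶ (A ⊞ A) ⊞ (A ⊞ A) :=
  biprod.lift (biprod.map biprod.fst biprod.fst) (biprod.map biprod.snd biprod.snd)

/-- The map `⟨π₁, 0, 0, π₂⟩`. -/
def vert (A : X) : A ⊞ A ⟶ (A ⊞ A) ⊞ (A ⊞ A) :=
  biprod.lift (biprod.lift biprod.fst 0) (biprod.lift 0 biprod.snd)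

/-- The map `⟨1, 0, 0, 1⟩`. -/
def unitB (A : X) : A ⟶ (A ⊞ A) ⊞ (A ⊞ A) :=
  biprod.lift (biprod.lift (𝟙 A) 0) (biprod.lift 0 (𝟙 A))

variable (X) in
/-- The diagonal functor `A ↦ A × A`. -/
abbrev B : X ⥤ X where
  obj A := A ⊞ A
  map f := biprod.map f f

/-- The power `A ^ (n + 1)`. -/
abbrev pow (n : ℕ) (A : X) : X := ⨁ fun _ : Fin (n + 1) => A

variable (X) in
/-- The functor `A ↦ A ^ (n + 1)`. -/
abbrev Bn (n : ℕ) : X ⥤ X where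
  obj A := pow n A
  map f := biproduct.map fun _ => f

/-- The projection `⟨π₁, πⱼ₊₁⟩` for `1 ≤ j ≤ n` (here `j` is counted from `0`). -/
def proj (n : ℕ) (j : Fin n) (A : X) : pow n A ⟶ A ⊞ A :=
  biprod.lift (biproduct.π _ 0) (biproduct.π _ j.succ)

/-- The injection `⟨π₁, 0, …, 0, π₂, 0, …, 0⟩` with `π₂` in position `j + 1`
(here `j` is counted from `0`). -/
def inj (n : ℕ) (j : Fin n) (A : X) : A ⊞ A ⟶ pow n A :=
  biprod.desc (biproduct.ι (fun _ : Fin (n + 1) => A) 0)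
    (biproduct.ι (fun _ : Fin (n + 1) => A) j.succ)

theorem outer_nat {A A' : X} (f : A ⟶ A') :
    biprod.map (biprod.map f f) (biprod.map f f) ≫ outer A' = outer A ≫ biprod.map f f := by
  ext <;> simp [outer]

theorem flipB_nat {A A' : X} (f : A ⟶ A') :
    biprod.map (biprod.map f f) (biprod.map f f) ≫ flipB A' =
      flipB A ≫ biprod.map (biprod.map f f) (biprod.map f f) := by
  ext <;> simp [flipB]

variable (X) in
/-- The adjoint biproduct tangent structure `𝔹°` on `Xᵒᵖ`. -/
def biproductDual : TangentData Xᵒᵖ :=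
  TangentData.ofDual (B X)
    { app := fun A => (biprod.lift (𝟙 A) 0 : A ⟶ A ⊞ A)
      naturality := fun A A' f =>
        show f ≫ biprod.lift (𝟙 A') 0 = biprod.lift (𝟙 A) 0 ≫ biprod.map f f by ext <;> simp }
    (Bn X)
    (fun n =>
      { app := fun A => biproduct.ι (fun _ : Fin (n + 1) => A) 0
        naturality := fun A A' f =>
          show f ≫ biproduct.ι (fun _ : Fin (n + 1) => A') 0 =
            biproduct.ι (fun _ : Fin (n + 1) => A) 0 ≫ biproduct.map fun _ => f by simp })
    (fun n j =>
      { app := inj n j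
        naturality := fun A A' f =>
          show biprod.map f f ≫ inj n j A' = inj n j A ≫ biproduct.map fun _ => f by
            apply biprod.hom_ext' <;> simp [inj] })
    { app := fun A => (biproduct.lift
        (Fin.cases biprod.fst fun _ => biprod.snd) : A ⊞ A ⟶ pow 2 A)
      naturality := fun A A' f =>
        show biprod.map f f ≫ biproduct.lift (Fin.cases biprod.fst fun _ => biprod.snd) =
            biproduct.lift (Fin.cases biprod.fst fun _ => biprod.snd) ≫ biproduct.map fun _ => f by
          apply biproduct.hom_ext; intro j; cases j using Fin.cases <;> simp }
    { app := fun A => (biprod.fst : A ⊞ A ⟶ A)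
      naturality := fun _ _ f => biprod.map_fst f f }
    { app := fun A => outer A
      naturality := fun _ _ f => outer_nat f }
    { app := fun A => flipB A
      naturality := fun _ _ f => flipB_nat f }

theorem comp_negHom [IsAdditive X] {A A' C : X} (f : A ⟶ A') (g : A' ⟶ C) :
    f ≫ negHom g = negHom (f ≫ g) := by
  have h : f ≫ g + f ≫ negHom g = 0 := by rw [← comp_add, add_negHom, comp_zero]
  exact (left_neg_eq_right_neg ((add_comm _ _).trans h) (add_negHom _))

theorem negHom_comp [IsAdditive X] {A A' C : X} (f : A ⟶ A') (g : A' ⟶ C) :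
    negHom f ≫ g = negHom (f ≫ g) := by
  have h : f ≫ g + negHom f ≫ g = 0 := by rw [← add_comp, add_negHom, zero_comp]
  exact (left_neg_eq_right_neg ((add_comm _ _).trans h) (add_negHom _))

/-- The map `⟨π₁, -π₂⟩`. -/
def negB [IsAdditive X] (A : X) : A ⊞ A ⟶ A ⊞ A := biprod.lift biprod.fst (negHom biprod.snd)

variable (X) in
/-- The negative map `⟨π₁, -π₂⟩` of the adjoint biproduct tangent structure. -/
def biproductDualNeg [IsAdditive X] : (biproductDual X).T ⟶ (biproductDual X).T :=
  NatTrans.op (F := B X) (G := B X)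
    { app := fun A => negB A
      naturality := fun A A' f =>
        show biprod.map f f ≫ negB A' = negB A ≫ biprod.map f f by
          simp only [negB]
          apply biprod.hom_ext <;> simp [comp_negHom, negHom_comp] }

/-- A differential combinator transformation on a monad `S`; together with `S` it is a
coCartesian differential monad. -/
structure DifferentialCombinator (S : Monad X) where
  /-- the natural transformation `∂_A : S(A) ⟶ S(A × A)` -/
  d : S.toFunctor ⟶ B X ⋙ S.toFunctor
  dc1 : ∀ A : X, d.app A ≫ S.map (biprod.fst : A ⊞ A ⟶ A) = 0
  dc2 : ∀ A : X,
    d.app A ≫ S.map (biprod.lift biprod.fst (biprod.lift biprod.snd biprod.snd) :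
      A ⊞ A ⟶ A ⊞ (A ⊞ A)) =
    d.app A ≫ S.map (biprod.lift biprod.fst (biprod.lift biprod.snd 0) : A ⊞ A ⟶ A ⊞ (A ⊞ A)) +
    d.app A ≫ S.map (biprod.lift biprod.fst (biprod.lift 0 biprod.snd) : A ⊞ A ⟶ A ⊞ (A ⊞ A))
  dc3 : ∀ A : X, S.η.app A ≫ d.app A = (biprod.lift 0 (𝟙 A) : A ⟶ A ⊞ A) ≫ S.η.app (A ⊞ A)
  dc4 : ∀ A : X, S.μ.app A ≫ d.app A =
    d.app (S.obj A) ≫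
      S.map ((biprod.fst ≫ S.map (biprod.lift (𝟙 A) 0 : A ⟶ A ⊞ A) + biprod.snd ≫ d.app A :
        S.obj A ⊞ S.obj A ⟶ S.obj (A ⊞ A))) ≫ S.μ.app (A ⊞ A)
  dc5 : ∀ A : X, d.app A ≫ d.app (A ⊞ A) ≫ S.map (outer A) = d.app A
  dc6 : ∀ A : X, d.app A ≫ d.app (A ⊞ A) ≫ S.map (flipB A) = d.app A ≫ d.app (A ⊞ A)

namespace DifferentialCombinator

variable {S : Monad X} (δ : DifferentialCombinator S)

/-- The map `S(π₁ + π₄) ∘ ∂_{A × A} : S(A × A) ⟶ S(A)`. -/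
def lam' (A : X) : S.obj (A ⊞ A) ⟶ S.obj A := δ.d.app (A ⊞ A) ≫ S.map (ends A)

/-- The underlying map of the distributive law
`λ_A = ⟨S(π₁), S(π₁ + π₄) ∘ ∂_{A × A}⟩ : S(A × A) ⟶ S(A) × S(A)`. -/
def lam (A : X) : S.obj (A ⊞ A) ⟶ S.obj A ⊞ S.obj A := biprod.lift (S.map biprod.fst) (δ.lam' A)

theorem d_nat {A A' : X} (f : A ⟶ A') :
    S.map f ≫ δ.d.app A' = δ.d.app A ≫ S.map (biprod.map f f) := δ.d.naturality f

theorem d_nat_assoc {A A' Z : X} (f : A ⟶ A') (h : S.obj (A' ⊞ A') ⟶ Z) :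
    S.map f ≫ δ.d.app A' ≫ h = δ.d.app A ≫ S.map (biprod.map f f) ≫ h := by
  rw [← Category.assoc, d_nat, Category.assoc]

theorem lam'_nat {A A' : X} (f : A ⟶ A') :
    S.map (biprod.map f f) ≫ δ.lam' A' = δ.lam' A ≫ S.map f := by
  have h : biprod.map (biprod.map f f) (biprod.map f f) ≫ ends A' = ends A ≫ f := by
    simp [ends, comp_add, add_comp]
  rw [lam', lam', d_nat_assoc, ← S.map_comp, h, S.map_comp, Category.assoc]

theorem map_lift_lam' {W A : X} (f g : W ⟶ A) :
    S.map (biprod.lift f g) ≫ δ.lam' A =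
      δ.d.app W ≫ S.map (biprod.fst ≫ f + biprod.snd ≫ g) := by
  have h : biprod.map (biprod.lift f g) (biprod.lift f g) ≫ ends A =
      biprod.fst ≫ f + biprod.snd ≫ g := by
    simp [ends, comp_add]
  rw [lam', d_nat_assoc, ← S.map_comp, h]

theorem eta_lam' (A : X) : S.η.app (A ⊞ A) ≫ δ.lam' A = biprod.snd ≫ S.η.app A := by
  have h : (biprod.lift 0 (𝟙 (A ⊞ A)) : A ⊞ A ⟶ _) ≫ ends A = biprod.snd := by
    simp [ends, comp_add]
  rw [lam', reassoc_of% (δ.dc3 (A ⊞ A)), ← S.η.naturality]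
  simp [reassoc_of% h]

theorem mu_lam' (A : X) :
    S.μ.app (A ⊞ A) ≫ δ.lam' A = S.map (δ.lam A) ≫ δ.lam' (S.obj A) ≫ S.μ.app A := by
  have h : (biprod.fst ≫ S.map (biprod.lift (𝟙 (A ⊞ A)) 0) + biprod.snd ≫ δ.d.app (A ⊞ A)) ≫
      S.map (ends A) = biprod.fst ≫ S.map biprod.fst + biprod.snd ≫ δ.lam' A := by
    rw [add_comp, Category.assoc, ← S.map_comp, Category.assoc]
    simp [ends, comp_add, lam']
  rw [lam, reassoc_of% (δ.map_lift_lam'), ← h, lam', reassoc_of% (δ.dc4 (A ⊞ A)), S.map_comp,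
    Category.assoc]
  have := S.μ.naturality (ends A)
  simp at this
  rw [← this]

theorem map_zero_lam' {W A : X} (f : W ⟶ A) : S.map (biprod.lift f 0) ≫ δ.lam' A = 0 := by
  have := δ.dc1 W
  rw [map_lift_lam', comp_zero, add_zero, S.map_comp, reassoc_of% this, zero_comp]

theorem map_add_lam' {W A : X} (f g h : W ⟶ A) :
    S.map (biprod.lift f (g + h)) ≫ δ.lam' A =
      S.map (biprod.lift f g) ≫ δ.lam' A + S.map (biprod.lift f h) ≫ δ.lam' A := by
  let k : W ⊞ (W ⊞ W) ⟶ A := biprod.fst ≫ f + biprod.snd ≫ (biprod.fst ≫ g + biprod.snd ≫ h)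
  have h1 : biprod.lift biprod.fst (biprod.lift biprod.snd biprod.snd) ≫ k =
      biprod.fst ≫ f + biprod.snd ≫ (g + h) := by simp [k, comp_add]
  have h2 : biprod.lift biprod.fst (biprod.lift biprod.snd 0) ≫ k =
      biprod.fst ≫ f + biprod.snd ≫ g := by simp [k, comp_add]
  have h3 : biprod.lift biprod.fst (biprod.lift 0 biprod.snd) ≫ k =
      biprod.fst ≫ f + biprod.snd ≫ h := by simp [k, comp_add]
  have e := congrArg (fun m => m ≫ S.map k) (δ.dc2 W)
  simp only [add_comp, Category.assoc, ← S.map_comp] at e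
  rw [map_lift_lam', map_lift_lam', map_lift_lam', ← h1, ← h2, ← h3, e]

theorem map_neg_lam' [IsAdditive X] {W A : X} (f g : W ⟶ A) :
    S.map (biprod.lift f (negHom g)) ≫ δ.lam' A = negHom (S.map (biprod.lift f g) ≫ δ.lam' A) := by
  have h := δ.map_add_lam' f g (negHom g)
  rw [add_negHom, map_zero_lam'] at h
  exact left_neg_eq_right_neg ((add_comm _ _).trans h.symm) (add_negHom _)

theorem lam'_lam' (A : X) : δ.lam' (A ⊞ A) ≫ δ.lam' A =
    δ.d.app _ ≫ δ.d.app _ ≫ S.map (biprod.map (ends (A ⊞ A)) (ends (A ⊞ A)) ≫ ends A) := by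
  rw [lam', lam', Category.assoc, d_nat_assoc, S.map_comp]

theorem vert_lam' (A : X) : S.map (vert A) ≫ δ.lam' (A ⊞ A) ≫ δ.lam' A = δ.lam' A := by
  have h : biprod.map (biprod.map (vert A) (vert A)) (biprod.map (vert A) (vert A)) ≫
      biprod.map (ends (A ⊞ A)) (ends (A ⊞ A)) ≫ ends A = outer (A ⊞ A) ≫ ends A := by
    simp [ends, vert, outer, comp_add, add_comp]
  rw [lam'_lam', d_nat_assoc, d_nat_assoc, ← S.map_comp, h, S.map_comp,
    reassoc_of% (δ.dc5 (A ⊞ A)), lam']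

theorem flipB_lam' (A : X) :
    S.map (flipB A) ≫ δ.lam' (A ⊞ A) ≫ δ.lam' A = δ.lam' (A ⊞ A) ≫ δ.lam' A := by
  have h : biprod.map (biprod.map (flipB A) (flipB A)) (biprod.map (flipB A) (flipB A)) ≫
      biprod.map (ends (A ⊞ A)) (ends (A ⊞ A)) ≫ ends A =
      flipB _ ≫ biprod.map (ends (A ⊞ A)) (ends (A ⊞ A)) ≫ ends A := by
    simp [ends, flipB, comp_add, add_comp]
    abel
  rw [lam'_lam', d_nat_assoc, d_nat_assoc, ← S.map_comp, h, S.map_comp,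
    reassoc_of% (δ.dc6 ((A ⊞ A) ⊞ (A ⊞ A)))]

/-- The structure map `(α × α) ∘ λ_A` on `A × A`, for an algebra `(A, α)`. -/
def tanStr (M : S.Algebra) : S.obj (M.A ⊞ M.A) ⟶ M.A ⊞ M.A := δ.lam M.A ≫ biprod.map M.a M.a

@[simp]
theorem tanStr_fst (M : S.Algebra) : δ.tanStr M ≫ biprod.fst = S.map biprod.fst ≫ M.a := by
  simp [tanStr, lam]

@[simp]
theorem tanStr_snd (M : S.Algebra) : δ.tanStr M ≫ biprod.snd = δ.lam' M.A ≫ M.a := by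
  simp [tanStr, lam]

theorem mu_lam'_a (M : S.Algebra) : S.μ.app (M.A ⊞ M.A) ≫ δ.lam' M.A ≫ M.a =
    S.map (δ.tanStr M) ≫ δ.lam' M.A ≫ M.a := by
  rw [reassoc_of% (δ.mu_lam' M.A), M.assoc, tanStr, S.map_comp, Category.assoc,
    reassoc_of% (δ.lam'_nat M.a)]

/-- The tangent bundle `(A × A, (α × α) ∘ λ_A)` of an algebra `(A, α)`. -/
def tanObj (M : S.Algebra) : S.Algebra where
  A := M.A ⊞ M.A
  a := δ.tanStr M
  unit := by
    apply biprod.hom_ext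
    · have := S.η.naturality (biprod.fst : M.A ⊞ M.A ⟶ M.A)
      simp only [Functor.id_map] at this
      simp [← reassoc_of% this, M.unit]
    · simp [reassoc_of% (δ.eta_lam' M.A), M.unit]
  assoc := by
    apply biprod.hom_ext
    · have := S.μ.naturality (biprod.fst : M.A ⊞ M.A ⟶ M.A)
      simp only [Functor.comp_map] at this
      rw [Category.assoc, Category.assoc, tanStr_fst, ← reassoc_of% this, M.assoc,
        ← S.map_comp_assoc, ← S.map_comp_assoc, tanStr_fst]
    · rw [Category.assoc, Category.assoc, tanStr_snd, mu_lam'_a]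

/-- The structure map of `Tₙ (A, α)`, on `A ^ (n + 1)`. -/
def tanStrN (n : ℕ) (M : S.Algebra) : S.obj (pow n M.A) ⟶ pow n M.A :=
  biproduct.lift (Fin.cases (S.map (biproduct.π _ 0) ≫ M.a)
    fun j => S.map (proj n j M.A) ≫ δ.lam' M.A ≫ M.a)

@[simp]
theorem tanStrN_zero (n : ℕ) (M : S.Algebra) :
    δ.tanStrN n M ≫ biproduct.π _ 0 = S.map (biproduct.π _ 0) ≫ M.a := by
  simp [tanStrN]

@[simp]
theorem tanStrN_succ (n : ℕ) (j : Fin n) (M : S.Algebra) :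
    δ.tanStrN n M ≫ biproduct.π _ j.succ = S.map (proj n j M.A) ≫ δ.lam' M.A ≫ M.a := by
  simp [tanStrN]

theorem tanStrN_proj (n : ℕ) (j : Fin n) (M : S.Algebra) :
    δ.tanStrN n M ≫ proj n j M.A = S.map (proj n j M.A) ≫ δ.tanStr M := by
  apply biprod.hom_ext
  · rw [Category.assoc, Category.assoc, tanStr_fst, ← S.map_comp_assoc]
    simp [proj]
  · rw [Category.assoc, Category.assoc, tanStr_snd]
    simp [proj]

/-- The `n`-fold pullback `Tₙ (A, α)` of the projection of the tangent bundle. -/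
def tanObjN (n : ℕ) (M : S.Algebra) : S.Algebra where
  A := pow n M.A
  a := δ.tanStrN n M
  unit := by
    apply biproduct.hom_ext
    intro j
    have h (k : pow n M.A ⟶ M.A ⊞ M.A) := S.η.naturality k
    have h0 := S.η.naturality (biproduct.π (fun _ : Fin (n + 1) => M.A) 0)
    simp only [Functor.id_map] at h h0
    cases j using Fin.cases with
    | zero => rw [Category.assoc, tanStrN_zero, ← reassoc_of% h0, M.unit]; simp
    | succ j =>
      rw [Category.assoc, tanStrN_succ, ← reassoc_of% (h (proj n j M.A)),
        reassoc_of% (δ.eta_lam' M.A), M.unit]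
      simp [proj]
  assoc := by
    apply biproduct.hom_ext
    intro j
    have h (k : pow n M.A ⟶ M.A ⊞ M.A) := S.μ.naturality k
    have h0 := S.μ.naturality (biproduct.π (fun _ : Fin (n + 1) => M.A) 0)
    simp only [Functor.comp_map] at h h0
    cases j using Fin.cases with
    | zero =>
      rw [Category.assoc, Category.assoc, tanStrN_zero, ← reassoc_of% h0, M.assoc,
        ← S.map_comp_assoc, ← S.map_comp_assoc, tanStrN_zero]
    | succ j =>
      rw [Category.assoc, Category.assoc, tanStrN_succ, ← reassoc_of% (h (proj n j M.A)),
        mu_lam'_a, ← S.map_comp_assoc, ← S.map_comp_assoc, tanStrN_proj]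

/-- To be an algebra morphism into `T M`, it suffices to look at the two components. -/
theorem hom_tan {M : S.Algebra} {P : X} {a : S.obj P ⟶ P} (f g : P ⟶ M.A)
    (hf : S.map f ≫ M.a = a ≫ f)
    (hg : S.map (biprod.lift f g) ≫ δ.lam' M.A ≫ M.a = a ≫ g) :
    S.map (biprod.lift f g) ≫ δ.tanStr M = a ≫ biprod.lift f g := by
  apply biprod.hom_ext
  · rw [Category.assoc, Category.assoc, tanStr_fst, ← S.map_comp_assoc]
    simp [hf]
  · rw [Category.assoc, Category.assoc, tanStr_snd, hg]
    simp

theorem sum_hom (M : S.Algebra) :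
    S.map (biprod.lift (biproduct.π (fun _ : Fin 3 => M.A) 0)
      (biproduct.π (fun _ : Fin 3 => M.A) 1 + biproduct.π (fun _ : Fin 3 => M.A) 2)) ≫
        δ.tanStr M =
    δ.tanStrN 2 M ≫ biprod.lift (biproduct.π (fun _ : Fin 3 => M.A) 0)
      (biproduct.π (fun _ : Fin 3 => M.A) 1 + biproduct.π (fun _ : Fin 3 => M.A) 2) := by
  apply δ.hom_tan
  · exact (δ.tanStrN_zero 2 M).symm
  · rw [← Category.assoc, map_add_lam', add_comp, comp_add, Category.assoc, Category.assoc]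
    exact congrArg₂ (· + ·) (δ.tanStrN_succ 2 0 M).symm (δ.tanStrN_succ 2 1 M).symm

theorem zero_hom (M : S.Algebra) :
    S.map (biprod.lift (𝟙 M.A) 0) ≫ δ.tanStr M = M.a ≫ biprod.lift (𝟙 M.A) 0 := by
  apply δ.hom_tan
  · simp
  · rw [reassoc_of% (δ.map_zero_lam' (𝟙 M.A))]
    simp

theorem neg_hom [IsAdditive X] (M : S.Algebra) :
    S.map (negB M.A) ≫ δ.tanStr M = δ.tanStr M ≫ negB M.A := by
  apply δ.hom_tan
  · simp
  · rw [← Category.assoc, map_neg_lam', comp_negHom, tanStr_snd, negHom_comp]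
    have : (biprod.lift biprod.fst biprod.snd : M.A ⊞ M.A ⟶ _) = 𝟙 _ := by
      apply biprod.hom_ext <;> simp
    simp [this]

theorem vert_hom (M : S.Algebra) :
    S.map (vert M.A) ≫ δ.tanStr (δ.tanObj M) = δ.tanStr M ≫ vert M.A := by
  apply δ.hom_tan (M := δ.tanObj M)
  · change S.map (biprod.lift biprod.fst 0) ≫ δ.tanStr M = _
    apply δ.hom_tan
    · simp
    · rw [reassoc_of% (δ.map_zero_lam' (W := M.A ⊞ M.A) biprod.fst)]
      simp
  · change S.map (vert M.A) ≫ δ.lam' (M.A ⊞ M.A) ≫ δ.tanStr M =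
      δ.tanStr M ≫ biprod.lift 0 biprod.snd
    apply biprod.hom_ext
    · have h : vert M.A ≫ biprod.map biprod.fst biprod.fst = biprod.lift biprod.fst 0 := by
        apply biprod.hom_ext <;> simp [vert]
      rw [Category.assoc, Category.assoc, Category.assoc, tanStr_fst,
        ← reassoc_of% (δ.lam'_nat (biprod.fst : M.A ⊞ M.A ⟶ M.A)),
        ← S.map_comp_assoc, h, reassoc_of% (δ.map_zero_lam' (W := M.A ⊞ M.A) biprod.fst)]
      simp
    · rw [Category.assoc, Category.assoc, Category.assoc, tanStr_snd,
        reassoc_of% (δ.vert_lam' M.A)]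
      simp

theorem flipB_hom (M : S.Algebra) :
    S.map (flipB M.A) ≫ δ.tanStr (δ.tanObj M) = δ.tanStr (δ.tanObj M) ≫ flipB M.A := by
  suffices H : ∀ t : S.obj ((M.A ⊞ M.A) ⊞ (M.A ⊞ M.A)) ⟶ (M.A ⊞ M.A) ⊞ (M.A ⊞ M.A),
      t ≫ biprod.fst = S.map biprod.fst ≫ δ.tanStr M →
      t ≫ biprod.snd = δ.lam' (M.A ⊞ M.A) ≫ δ.tanStr M →
      S.map (flipB M.A) ≫ t = t ≫ flipB M.A from
    H _ (δ.tanStr_fst (δ.tanObj M)) (δ.tanStr_snd (δ.tanObj M))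
  intro t e1 e2
  have f1 : flipB M.A ≫ biprod.fst = biprod.map biprod.fst biprod.fst := by simp [flipB]
  have f2 : flipB M.A ≫ biprod.snd = biprod.map biprod.snd biprod.snd := by simp [flipB]
  have f3 : flipB M.A ≫ biprod.map biprod.fst biprod.fst = biprod.fst := by
    apply biprod.hom_ext <;> simp [flipB]
  apply biprod.hom_ext
  · rw [Category.assoc, Category.assoc, e1, f1, ← S.map_comp_assoc, f1]
    apply biprod.hom_ext
    · rw [Category.assoc, Category.assoc, tanStr_fst, biprod.map_fst, reassoc_of% e1, tanStr_fst,
        ← S.map_comp_assoc, ← S.map_comp_assoc, biprod.map_fst]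
    · rw [Category.assoc, Category.assoc, tanStr_snd, biprod.map_snd, reassoc_of% e2, tanStr_fst,
        reassoc_of% (δ.lam'_nat (biprod.fst : M.A ⊞ M.A ⟶ M.A))]
  · rw [Category.assoc, Category.assoc, e2, f2]
    apply biprod.hom_ext
    · rw [Category.assoc, Category.assoc, Category.assoc, tanStr_fst, biprod.map_fst,
        reassoc_of% e1, tanStr_snd, ← reassoc_of% (δ.lam'_nat (biprod.fst : M.A ⊞ M.A ⟶ M.A)),
        ← S.map_comp_assoc, f3]
    · rw [Category.assoc, Category.assoc, Category.assoc, tanStr_snd, biprod.map_snd,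
        reassoc_of% e2, tanStr_snd, reassoc_of% (δ.flipB_lam' M.A)]

theorem map_lam'_a {M N : S.Algebra} (f : M ⟶ N) :
    S.map (biprod.map f.f f.f) ≫ δ.lam' N.A ≫ N.a = δ.lam' M.A ≫ M.a ≫ f.f := by
  rw [reassoc_of% (δ.lam'_nat f.f), f.h]

/-- The tangent bundle functor on algebras. -/
def tan : S.Algebra ⥤ S.Algebra where
  obj M := δ.tanObj M
  map {M N} f :=
    { f := (biprod.map f.f f.f : M.A ⊞ M.A ⟶ N.A ⊞ N.A)
      h := by
        change S.map (biprod.map f.f f.f) ≫ δ.tanStr N = δ.tanStr M ≫ biprod.map f.f f.f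
        apply biprod.hom_ext
        · rw [Category.assoc, Category.assoc, tanStr_fst, ← S.map_comp_assoc]
          simp [reassoc_of% (δ.tanStr_fst M)]
        · rw [Category.assoc, Category.assoc, tanStr_snd, map_lam'_a]
          simp [reassoc_of% (δ.tanStr_snd M)] }
  map_id M := by ext1; change biprod.map (𝟙 M.A) (𝟙 M.A) = 𝟙 (M.A ⊞ M.A); ext <;> simp
  map_comp f g := by
    ext1
    change biprod.map (f.f ≫ g.f) (f.f ≫ g.f) = biprod.map f.f f.f ≫ biprod.map g.f g.f
    ext <;> simp

/-- The functors `Tₙ` on algebras. -/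
def tanN (n : ℕ) : S.Algebra ⥤ S.Algebra where
  obj M := δ.tanObjN n M
  map {M N} f :=
    { f := (biproduct.map fun _ => f.f : pow n M.A ⟶ pow n N.A)
      h := by
        change S.map (biproduct.map fun _ => f.f) ≫ δ.tanStrN n N =
          δ.tanStrN n M ≫ biproduct.map fun _ => f.f
        have hp (j : Fin n) : (biproduct.map fun _ => f.f) ≫ proj n j N.A =
            proj n j M.A ≫ biprod.map f.f f.f := by
          apply biprod.hom_ext <;> simp [proj]
        apply biproduct.hom_ext
        intro j
        cases j using Fin.cases with
        | zero =>
          rw [Category.assoc, Category.assoc, tanStrN_zero, ← S.map_comp_assoc]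
          simp [reassoc_of% (δ.tanStrN_zero n M)]
        | succ j =>
          rw [Category.assoc, Category.assoc, tanStrN_succ, ← S.map_comp_assoc, hp, S.map_comp,
            Category.assoc, map_lam'_a]
          simp [reassoc_of% (δ.tanStrN_succ n j M)] }
  map_id M := by
    ext1
    change biproduct.map (fun _ => 𝟙 M.A) = 𝟙 (pow n M.A)
    apply biproduct.hom_ext
    simp
  map_comp f g := by
    ext1
    change biproduct.map (fun _ => f.f ≫ g.f) =
      biproduct.map (fun _ => f.f) ≫ biproduct.map (fun _ => g.f)
    apply biproduct.hom_ext
    simp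

/-- The tangent structure `T` on the category of algebras of a coCartesian differential monad. -/
def tangent : TangentData S.Algebra where
  T := δ.tan
  p :=
    { app := fun M =>
        { f := (biprod.fst : M.A ⊞ M.A ⟶ M.A)
          h := (δ.tanStr_fst M).symm }
      naturality := fun M N f => by
        ext1
        exact biprod.map_fst f.f f.f }
  Tn := δ.tanN
  b n :=
    { app := fun M =>
        { f := (biproduct.π _ 0 : pow n M.A ⟶ M.A)
          h := (δ.tanStrN_zero n M).symm }
      naturality := fun M N f => by
        ext1
        change (biproduct.map fun _ => f.f) ≫ biproduct.π (fun _ : Fin (n + 1) => N.A) 0 =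
          biproduct.π (fun _ : Fin (n + 1) => M.A) 0 ≫ f.f
        simp }
  q n j :=
    { app := fun M =>
        { f := (proj n j M.A : pow n M.A ⟶ M.A ⊞ M.A)
          h := (δ.tanStrN_proj n j M).symm }
      naturality := fun M N f => by
        ext1
        change (biproduct.map fun _ => f.f) ≫ proj n j N.A = proj n j M.A ≫ biprod.map f.f f.f
        apply biprod.hom_ext <;> simp [proj] }
  s :=
    { app := fun M =>
        { f := (biprod.lift (biproduct.π (fun _ : Fin 3 => M.A) 0)
            (biproduct.π (fun _ : Fin 3 => M.A) 1 + biproduct.π (fun _ : Fin 3 => M.A) 2) :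
            pow 2 M.A ⟶ M.A ⊞ M.A)
          h := δ.sum_hom M }
      naturality := fun M N f => by
        ext1
        change (biproduct.map fun _ => f.f) ≫ biprod.lift (biproduct.π (fun _ : Fin 3 => N.A) 0)
            (biproduct.π (fun _ : Fin 3 => N.A) 1 + biproduct.π (fun _ : Fin 3 => N.A) 2) =
          biprod.lift (biproduct.π (fun _ : Fin 3 => M.A) 0)
            (biproduct.π (fun _ : Fin 3 => M.A) 1 + biproduct.π (fun _ : Fin 3 => M.A) 2) ≫
          biprod.map f.f f.f
        apply biprod.hom_ext <;> simp [comp_add, add_comp] }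
  z :=
    { app := fun M =>
        { f := (biprod.lift (𝟙 M.A) 0 : M.A ⟶ M.A ⊞ M.A)
          h := δ.zero_hom M }
      naturality := fun M N f => by
        ext1
        change f.f ≫ biprod.lift (𝟙 N.A) 0 = biprod.lift (𝟙 M.A) 0 ≫ biprod.map f.f f.f
        apply biprod.hom_ext <;> simp }
  l :=
    { app := fun M =>
        { f := (vert M.A : M.A ⊞ M.A ⟶ (M.A ⊞ M.A) ⊞ (M.A ⊞ M.A))
          h := δ.vert_hom M }
      naturality := fun M N f => by
        ext1
        change biprod.map f.f f.f ≫ vert N.A =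
          vert M.A ≫ biprod.map (biprod.map f.f f.f) (biprod.map f.f f.f)
        simp only [vert]
        ext <;> simp }
  c :=
    { app := fun M =>
        { f := (flipB M.A : (M.A ⊞ M.A) ⊞ (M.A ⊞ M.A) ⟶ (M.A ⊞ M.A) ⊞ (M.A ⊞ M.A))
          h := δ.flipB_hom M }
      naturality := fun M N f => by
        ext1
        exact flipB_nat f.f }

/-- The negative map `⟨π₁, -π₂⟩` of the tangent structure on algebras. -/
def tangentNeg [IsAdditive X] : δ.tangent.T ⟶ δ.tangent.T where
  app M :=
    { f := (negB M.A : M.A ⊞ M.A ⟶ M.A ⊞ M.A)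
      h := δ.neg_hom M }
  naturality M N f := by
    ext1
    change biprod.map f.f f.f ≫ negB N.A = negB M.A ≫ biprod.map f.f f.f
    simp only [negB]
    apply biprod.hom_ext <;> simp [comp_negHom, negHom_comp]

/-- The distributive law `λ_A`, as an algebra morphism `F(A × A) ⟶ T F(A)`. -/
def lamHom (A : X) : S.free.obj (A ⊞ A) ⟶ δ.tan.obj (S.free.obj A) where
  f := δ.lam A
  h := by
    change S.map (δ.lam A) ≫ δ.tanStr (S.free.obj A) = S.μ.app (A ⊞ A) ≫ δ.lam A
    suffices H : ∀ t : S.obj (S.obj A ⊞ S.obj A) ⟶ S.obj A ⊞ S.obj A,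
        t ≫ biprod.fst = S.map biprod.fst ≫ S.μ.app A →
        t ≫ biprod.snd = δ.lam' (S.obj A) ≫ S.μ.app A →
        S.map (δ.lam A) ≫ t = S.μ.app (A ⊞ A) ≫ δ.lam A from
      H _ (δ.tanStr_fst (S.free.obj A)) (δ.tanStr_snd (S.free.obj A))
    intro t e1 e2
    have h := S.μ.naturality (biprod.fst : A ⊞ A ⟶ A)
    simp only [Functor.comp_map] at h
    apply biprod.hom_ext
    · rw [Category.assoc, Category.assoc, e1, ← S.map_comp_assoc]
      simp [lam, h]
    · rw [Category.assoc, Category.assoc, e2, ← mu_lam']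
      simp [lam]

/-- The mate of `λ`: the comparison map
`τ_A = ε_{F(A × A)} ∘ T°(λ_{A × A}) ∘ T°(F⟨1, 0, 0, 1⟩) : T° F(A) ⟶ F(A × A)`
determined by an adjunction `T° ⊣ T` with counit `ε`. -/
def tau (E : δ.tangent.Adjoints) (A : X) :
    (S.free ⋙ E.L).obj A ⟶ (B X ⋙ S.free).obj A :=
  E.L.map (S.free.map (unitB A)) ≫ E.L.map (δ.lamHom (A ⊞ A)) ≫
    E.adj.counit.app (S.free.obj (A ⊞ A))

/-- The natural transformation `F^op 𝔹° ⟶ T° F^op` of functors `Xᵒᵖ ⥤ ALG_Sᵒᵖ` given by a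
natural transformation `T° F ⟶ F 𝔹`. -/
def tauOp (E : δ.tangent.Adjoints) (τ : S.free ⋙ E.L ⟶ B X ⋙ S.free) :
    (biproductDual X).T ⋙ S.free.op ⟶ S.free.op ⋙ (δ.tangent.dual E).T where
  app A := (τ.app A.unop).op
  naturality _ _ f := Quiver.Hom.unop_inj (τ.naturality f.unop).symm

end DifferentialCombinator

end CoCartesianDiff

end

noncomputable section

open TangentCat

/-! ## Universal properties in elementary form -/

namespace TangentCat

variable {C : Type u} [Category.{v} C]

/-! The structure maps of `𝕋` are, on carriers, those of the biproduct tangent structure of `X`, and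
they are already known to be algebra morphisms. The forgetful functor is faithful, so every
equational axiom of `𝕋` is an identity between matrices in `X`. The pullbacks `Tₙ` and the equalizer
of the vertical lift exist on carriers, and the induced maps turn out to be algebra morphisms
(`isNFoldPullback_tangent`, `isEqualizer_vertA`). Each `Tₙ` lifts the functor `A ↦ A ^ (n + 1)`
along the monadic forgetful functor. That functor is its own left adjoint because powers are
biproducts, so the adjoint lifting theorem with reflexive coequalizers gives left adjoints
(`isRightAdjoint_tan`, `isRightAdjoint_tanN`). Right adjoints preserve limits, so the clauses about
all powers of `T` reduce to the power zero.

The dual structure is treated for an arbitrary adjoint tangent structure. Under `Hom(T°A, Y) ≅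
Hom(A, T Y)`, precomposition with a mate becomes postcomposition with the original structure map, so
an axiom for `T°` is tested on maps out of its target and becomes an axiom for `T`
(`isTangent_dual`). Transposing twice interchanges inner and outer copies of `T`; the flip `c`
undoes this, which is why the axioms of `T` are needed in flipped form. Since `T°` has a right
adjoint, its opposite is again a right adjoint, and the powers cause no trouble.

For free algebras, `Hom(T°F(A), Y) ≅ Hom(F(A), T Y) ≅ Hom(A, Y × Y) ≅ Hom(A × A, Y) ≅ Hom(F(A × A),
Y)`, and `ev_tau_comp` shows that `τ` realizes this chain. Hence `τ` is invertible by Yoneda, and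
its compatibility with each structure map is an identity between matrices relating `𝔹°` to its
mates. Strongness and preservation of products hold because `F` is a left adjoint, so that its
opposite preserves limits. -/

theorem isNFoldPullback_iff {n : ℕ} {E A P : C} (p : E ⟶ A) (b : P ⟶ A) (q : Fin n → (P ⟶ E)) :
    IsNFoldPullback p b q ↔ (∀ j, q j ≫ p = b) ∧
      ∀ {Y : C} (g : Y ⟶ A) (f : Fin n → (Y ⟶ E)), (∀ j, f j ≫ p = g) →
        ∃! u : Y ⟶ P, u ≫ b = g ∧ ∀ j, u ≫ q j = f j := by
  constructor
  · rintro ⟨w, ⟨h⟩⟩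
    refine ⟨w, fun {Y} g f hf => ?_⟩
    let s : Cone (WidePullbackShape.wideCospan A (fun _ : Fin n => E) (fun _ => p)) :=
      WidePullbackShape.mkCone
        (F := WidePullbackShape.wideCospan A (fun _ : Fin n => E) (fun _ => p)) g f hf
    refine ⟨h.lift s, ⟨h.fac s none, fun j => h.fac s (some j)⟩, ?_⟩
    rintro u ⟨hu, hu'⟩
    refine h.uniq s u ?_
    rintro (_ | j)
    · exact hu
    · exact hu' j
  · rintro ⟨w, h⟩
    refine ⟨w, ⟨?_⟩⟩
    have hs (s : Cone (WidePullbackShape.wideCospan A (fun _ : Fin n => E) (fun _ => p)))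
        (j : Fin n) : s.π.app (some j) ≫ p = s.π.app none :=
      s.w (WidePullbackShape.Hom.term j)
    refine
      { lift := fun s => (h (s.π.app none) (fun j => s.π.app (some j)) (hs s)).choose
        fac := fun s j => ?_
        uniq := fun s m hm => ?_ }
    · have := (h (s.π.app none) (fun j => s.π.app (some j)) (hs s)).choose_spec.1
      cases j with
      | none => exact this.1
      | some j => exact this.2 j
    · exact (h (s.π.app none) (fun j => s.π.app (some j)) (hs s)).choose_spec.2 m
        ⟨hm none, fun j => hm (some j)⟩

theorem isEqualizer_iff {P Y Z : C} (i : P ⟶ Y) (f g : Y ⟶ Z) :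
    IsEqualizer i f g ↔ i ≫ f = i ≫ g ∧
      ∀ {W : C} (k : W ⟶ Y), k ≫ f = k ≫ g → ∃! u : W ⟶ P, u ≫ i = k := by
  constructor
  · rintro ⟨w, ⟨h⟩⟩
    refine ⟨w, fun {W} k hk => ⟨Fork.IsLimit.lift h k hk, Fork.IsLimit.lift_ι' h k hk, ?_⟩⟩
    intro u hu
    exact Fork.IsLimit.hom_ext h (hu.trans (Fork.IsLimit.lift_ι' h k hk).symm)
  · rintro ⟨w, h⟩
    exact ⟨w, ⟨Fork.IsLimit.mk _ (fun s => (h s.ι s.condition).choose)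
      (fun s => (h s.ι s.condition).choose_spec.1)
      (fun s m hm => (h s.ι s.condition).choose_spec.2 m hm)⟩⟩

section RightAdjoint

universe v' u'

variable {C' : Type u'} [Category.{v'} C'] (G : C ⥤ C') [G.IsRightAdjoint]

/-- Cones over the image transpose to cones over the original diagram. Together with
`IsEqualizer.map` this serves the powers of the various tangent functors as well as the opposite of
the free algebra functor. -/
theorem IsNFoldPullback.map {n : ℕ} {E A P : C} {p : E ⟶ A} {b : P ⟶ A} {q : Fin n → (P ⟶ E)}
    (h : IsNFoldPullback p b q) :
    IsNFoldPullback (G.map p) (G.map b) (fun j => G.map (q j)) := by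
  rw [isNFoldPullback_iff] at h ⊢
  refine ⟨fun j => by rw [← G.map_comp, h.1], fun {Y} g f hf => ?_⟩
  let e := Adjunction.ofIsRightAdjoint G
  obtain ⟨u, ⟨hu, hu'⟩, huniq⟩ := h.2 ((e.homEquiv _ _).symm g)
    (fun j => (e.homEquiv _ _).symm (f j)) fun j => by
      rw [← e.homEquiv_naturality_right_symm, hf]
  refine ⟨e.homEquiv _ _ u, ⟨?_, fun j => ?_⟩, ?_⟩
  · rw [← e.homEquiv_naturality_right, hu, Equiv.apply_symm_apply]
  · rw [← e.homEquiv_naturality_right, hu', Equiv.apply_symm_apply]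
  · rintro k ⟨hk, hk'⟩
    rw [← Equiv.symm_apply_eq]
    refine huniq _ ⟨?_, fun j => ?_⟩
    · rw [← e.homEquiv_naturality_right_symm, hk]
    · rw [← e.homEquiv_naturality_right_symm, hk']

theorem IsEqualizer.map {P Y Z : C} {i : P ⟶ Y} {f g : Y ⟶ Z} (h : IsEqualizer i f g) :
    IsEqualizer (G.map i) (G.map f) (G.map g) := by
  rw [isEqualizer_iff] at h ⊢
  refine ⟨by rw [← G.map_comp, h.1, G.map_comp], fun {W} k hk => ?_⟩
  let e := Adjunction.ofIsRightAdjoint G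
  obtain ⟨u, hu, huniq⟩ := h.2 ((e.homEquiv _ _).symm k) (by
    rw [← e.homEquiv_naturality_right_symm, hk, e.homEquiv_naturality_right_symm])
  refine ⟨e.homEquiv _ _ u, ?_, fun m hm => ?_⟩
  · beta_reduce
    rw [← e.homEquiv_naturality_right, hu, Equiv.apply_symm_apply]
  · rw [← Equiv.symm_apply_eq]
    refine huniq _ ?_
    beta_reduce at hm ⊢
    rw [← e.homEquiv_naturality_right_symm, hm]

theorem isRightAdjoint_iter (F : C ⥤ C) [F.IsRightAdjoint] (m : ℕ) :
    (iter F m).IsRightAdjoint := by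
  induction m with
  | zero => exact inferInstanceAs (𝟭 C).IsRightAdjoint
  | succ m ih => exact inferInstanceAs (iter F m ⋙ F).IsRightAdjoint

end RightAdjoint

end TangentCat

/-! ## The dual of an adjoint tangent structure -/

/-- Follows from the unit identity for conjugate transformations and naturality of `α`. The rules
for mates below are all instances. -/
theorem CategoryTheory.Adjunction.homEquiv_conjugateEquiv_symm_app_comp
    {C : Type u} [Category.{v} C] {C' : Type*} [Category* C']
    {L₁ L₂ : C ⥤ C'} {R₁ R₂ : C' ⥤ C} (adj₁ : L₁ ⊣ R₁) (adj₂ : L₂ ⊣ R₂) (α : R₁ ⟶ R₂)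
    {A : C} {Y : C'} (f : L₁.obj A ⟶ Y) :
    adj₂.homEquiv A Y (((conjugateEquiv adj₁ adj₂).symm α).app A ≫ f) =
      adj₁.homEquiv A Y f ≫ α.app Y := by
  have h := unit_conjugateEquiv_symm adj₁ adj₂ α A
  dsimp at h
  simp only [Adjunction.homEquiv_unit, Functor.map_comp, Category.assoc]
  rw [← reassoc_of% h, α.naturality]

theorem CategoryTheory.Adjunction.id_homEquiv_apply {C : Type u} [Category.{v} C] {A Y : C}
    (f : A ⟶ Y) : (Adjunction.id (C := C)).homEquiv A Y f = f := by
  rw [Adjunction.homEquiv_unit]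
  exact Category.id_comp f

namespace TangentData

variable {C : Type u} [Category.{v} C] (D : TangentData C)

/-! ### Components of the structure maps and consequences of the axioms. -/

section Components

variable (A : C)

/-- The component of the projection at `A`. -/
def pA : D.T.obj A ⟶ A := D.p.app A

/-- The component at `A` of the projection of the `n`-fold pullback to the base. -/
def bA (n : ℕ) : (D.Tn n).obj A ⟶ A := (D.b n).app A

/-- The component at `A` of the pullback projections. -/
def qA (n : ℕ) (j : Fin n) : (D.Tn n).obj A ⟶ D.T.obj A := (D.q n j).app A

/-- The component of the sum at `A`. -/
def sA : (D.Tn 2).obj A ⟶ D.T.obj A := D.s.app A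

/-- The component of the zero at `A`. -/
def zA : A ⟶ D.T.obj A := D.z.app A

/-- The component of the vertical lift at `A`. -/
def lA : D.T.obj A ⟶ D.T.obj (D.T.obj A) := D.l.app A

/-- The component of the canonical flip at `A`. -/
def cA : D.T.obj (D.T.obj A) ⟶ D.T.obj (D.T.obj A) := D.c.app A

variable {A} in
theorem pA_nat {Y : C} (f : A ⟶ Y) : D.T.map f ≫ D.pA Y = D.pA A ≫ f := D.p.naturality f

variable {A} in
theorem zA_nat {Y : C} (f : A ⟶ Y) : f ≫ D.zA Y = D.zA A ≫ D.T.map f := D.z.naturality f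

end Components

variable {D}

namespace IsTangent

variable (h : D.IsTangent) (A : C)
include h

theorem qA_pA (n : ℕ) (j : Fin n) : D.qA A n j ≫ D.pA A = D.bA A n :=
  ((isNFoldPullback_iff _ _ _).1 (h.isPullback 0 n A)).1 j

variable {A} in
theorem exists_unique_lift {Y : C} (n : ℕ) (g : Y ⟶ A) (f : Fin n → (Y ⟶ D.T.obj A))
    (hf : ∀ j, f j ≫ D.pA A = g) :
    ∃! u : Y ⟶ (D.Tn n).obj A, u ≫ D.bA A n = g ∧ ∀ j, u ≫ D.qA A n j = f j :=
  ((isNFoldPullback_iff _ _ _).1 (h.isPullback 0 n A)).2 g f hf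

variable {A} in
theorem exists_unique_lift_T {Y : C} (n : ℕ) (g : Y ⟶ D.T.obj A)
    (f : Fin n → (Y ⟶ D.T.obj (D.T.obj A))) (hf : ∀ j, f j ≫ D.T.map (D.pA A) = g) :
    ∃! u : Y ⟶ D.T.obj ((D.Tn n).obj A), u ≫ D.T.map (D.bA A n) = g ∧
      ∀ j, u ≫ D.T.map (D.qA A n j) = f j :=
  ((isNFoldPullback_iff _ _ _).1 (h.isPullback 1 n A)).2 g f hf

variable {A} in
-- The base projection need not be tested, being `q₀ ≫ p`.
theorem hom_ext_two {Y : C} {u u' : Y ⟶ (D.Tn 2).obj A}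
    (h0 : u ≫ D.qA A 2 0 = u' ≫ D.qA A 2 0) (h1 : u ≫ D.qA A 2 1 = u' ≫ D.qA A 2 1) : u = u' := by
  refine (h.exists_unique_lift 2 (u ≫ D.bA A 2) (fun j => u ≫ D.qA A 2 j)
    fun j => by rw [Category.assoc, h.qA_pA]).unique ⟨rfl, fun j => rfl⟩ ⟨?_, fun j => ?_⟩
  · rw [← h.qA_pA A 2 0, reassoc_of% h0]
  · match j with
    | 0 => exact h0.symm
    | 1 => exact h1.symm

theorem sA_pA : D.sA A ≫ D.pA A = D.bA A 2 := h.s_p A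
theorem zA_pA : D.zA A ≫ D.pA A = 𝟙 A := h.z_p A
theorem lA_Tp : D.lA A ≫ D.T.map (D.pA A) = D.pA A ≫ D.zA A := h.l_p A
theorem zA_lA : D.zA A ≫ D.lA A = D.zA A ≫ D.T.map (D.zA A) := h.z_l A
theorem cA_pA : D.cA A ≫ D.pA (D.T.obj A) = D.T.map (D.pA A) := h.c_p A
theorem Tz_cA : D.T.map (D.zA A) ≫ D.cA A = D.zA (D.T.obj A) := h.z_c A
theorem cA_cA : D.cA A ≫ D.cA A = 𝟙 _ := h.c_c A
theorem lA_cA : D.lA A ≫ D.cA A = D.lA A := h.l_c A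
theorem lA_Tl : D.lA A ≫ D.T.map (D.lA A) = D.lA A ≫ D.lA (D.T.obj A) := h.l_l A
theorem cA_cA_cA : D.T.map (D.cA A) ≫ D.cA (D.T.obj A) ≫ D.T.map (D.cA A) =
    D.cA (D.T.obj A) ≫ D.T.map (D.cA A) ≫ D.cA (D.T.obj A) := h.c_c_c A
theorem lA_cA_cA : D.lA (D.T.obj A) ≫ D.T.map (D.cA A) ≫ D.cA (D.T.obj A) =
    D.cA A ≫ D.T.map (D.lA A) := h.l_c_c A

/-- As `c` is an involution, each axiom passing from `T` of a structure map to the structure map at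
`T A` can be read backwards. The reversed forms are the ones met after transposing twice. -/
theorem zA_cA : D.zA (D.T.obj A) ≫ D.cA A = D.T.map (D.zA A) := by
  rw [← h.Tz_cA, Category.assoc, h.cA_cA, Category.comp_id]

theorem cA_Tp : D.cA A ≫ D.T.map (D.pA A) = D.pA (D.T.obj A) := by
  rw [← h.cA_pA, reassoc_of% (h.cA_cA A)]

theorem lA_pA : D.lA A ≫ D.pA (D.T.obj A) = D.pA A ≫ D.zA A := by
  rw [← h.lA_cA, Category.assoc, h.cA_pA, h.lA_Tp]

/-- The axiom `l_c_c` solved for `l_T`, by cancelling the involutions `c`, `c_T` and `T(c)`. -/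
theorem Tl_cA_cA : D.T.map (D.lA A) ≫ D.cA (D.T.obj A) ≫ D.T.map (D.cA A) =
    D.cA A ≫ D.lA (D.T.obj A) := by
  have hc : D.T.map (D.cA A) ≫ D.T.map (D.cA A) = 𝟙 _ := by
    rw [← D.T.map_comp, h.cA_cA, D.T.map_id]
  have e := congrArg (fun m => D.cA A ≫ m ≫ D.cA (D.T.obj A) ≫ D.T.map (D.cA A)) (h.lA_cA_cA A)
  simp only [Category.assoc, reassoc_of% (h.cA_cA A), reassoc_of% (h.cA_cA (D.T.obj A)), hc,
    Category.comp_id] at e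
  exact e.symm

/-- The flip exchanges `T (T₂ A)` and `T₂ (T A)`. -/
theorem exists_flip_two : ∃ v : D.T.obj ((D.Tn 2).obj A) ⟶ (D.Tn 2).obj (D.T.obj A),
    (∀ j, v ≫ D.qA (D.T.obj A) 2 j = D.T.map (D.qA A 2 j) ≫ D.cA A) ∧
      v ≫ D.sA (D.T.obj A) = D.T.map (D.sA A) ≫ D.cA A := by
  obtain ⟨v, h0, h1, hv⟩ := h.s_c A
  refine ⟨v, fun j => ?_, hv⟩
  match j with
  | 0 => exact h0
  | 1 => exact h1

/-- Here `v` exists because `T` preserves the pullback `T₂`. Its additivity is inherited from the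
flip in the other direction, for which `v` is a section. -/
theorem exists_flip_two_inv : ∃ v : (D.Tn 2).obj (D.T.obj A) ⟶ D.T.obj ((D.Tn 2).obj A),
    (∀ j, v ≫ D.T.map (D.qA A 2 j) = D.qA (D.T.obj A) 2 j ≫ D.cA A) ∧
      v ≫ D.T.map (D.sA A) = D.sA (D.T.obj A) ≫ D.cA A := by
  obtain ⟨v, ⟨-, hq⟩, -⟩ := h.exists_unique_lift_T 2 (D.bA (D.T.obj A) 2)
    (fun j => D.qA (D.T.obj A) 2 j ≫ D.cA A)
    fun j => by rw [Category.assoc, h.cA_Tp, h.qA_pA]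
  refine ⟨v, hq, ?_⟩
  obtain ⟨v', hq', hs'⟩ := h.exists_flip_two A
  have hv : v ≫ v' = 𝟙 _ := by
    apply h.hom_ext_two <;>
      rw [Category.assoc, hq', reassoc_of% hq, h.cA_cA, Category.comp_id, Category.id_comp]
  have e : v ≫ D.T.map (D.sA A) ≫ D.cA A = D.sA (D.T.obj A) := by
    rw [← hs', reassoc_of% hv]
  rw [← e, Category.assoc, Category.assoc, h.cA_cA, Category.comp_id]

/-- The vertical lift is additive for the addition of `p_{T A}`. -/
theorem exists_lift_lA : ∃ u : (D.Tn 2).obj A ⟶ (D.Tn 2).obj (D.T.obj A),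
    (∀ j, u ≫ D.qA (D.T.obj A) 2 j = D.qA A 2 j ≫ D.lA A) ∧
      u ≫ D.sA (D.T.obj A) = D.sA A ≫ D.lA A := by
  obtain ⟨u, hu, hs⟩ := h.s_l A
  replace hu (j) : u ≫ D.T.map (D.qA A 2 j) = D.qA A 2 j ≫ D.lA A := hu j
  replace hs : D.sA A ≫ D.lA A = u ≫ D.T.map (D.sA A) := hs
  obtain ⟨v, hq, hv⟩ := h.exists_flip_two A
  refine ⟨u ≫ v, fun j => ?_, ?_⟩
  · rw [Category.assoc, hq, reassoc_of% (hu j), h.lA_cA]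
  · rw [Category.assoc, hv, ← reassoc_of% hs, h.lA_cA]

variable {A} in
-- The flip turns `T(s)` into the sum at `T A` and `z_T` into `T(z)`, and it fixes `l`. This is the
-- shape that `T°(s°)` produces after transposition.
theorem exists_of_isVertical {w : (D.Tn 2).obj A ⟶ D.T.obj (D.T.obj A)}
    (hw : D.IsVertical A w) : ∃ u : (D.Tn 2).obj A ⟶ (D.Tn 2).obj (D.T.obj A),
      u ≫ D.qA (D.T.obj A) 2 0 = D.qA A 2 0 ≫ D.lA A ∧
      u ≫ D.qA (D.T.obj A) 2 1 = D.qA A 2 1 ≫ D.T.map (D.zA A) ∧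
      u ≫ D.sA (D.T.obj A) = w ≫ D.cA A := by
  obtain ⟨u, hu0, hu1, rfl⟩ := hw
  replace hu0 : u ≫ D.T.map (D.qA A 2 0) = D.qA A 2 0 ≫ D.lA A := hu0
  replace hu1 : u ≫ D.T.map (D.qA A 2 1) = D.qA A 2 1 ≫ D.zA (D.T.obj A) := hu1
  change ∃ _, _ ∧ _ ∧ _ = (u ≫ D.T.map (D.sA A)) ≫ D.cA A
  obtain ⟨v, hq, hv⟩ := h.exists_flip_two A
  refine ⟨u ≫ v, ?_, ?_, ?_⟩
  · rw [Category.assoc, hq, reassoc_of% hu0, h.lA_cA]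
  · rw [Category.assoc, hq, reassoc_of% hu1, h.zA_cA]
  · rw [Category.assoc, hv, Category.assoc]

end IsTangent

/-! ### Mates, and transposition along `T° ⊣ T`. -/

namespace Adjoints

variable (E : D.Adjoints)

/-- Transposition along `T° ⊣ T`. -/
def tr {A Y : C} : (E.L.obj A ⟶ Y) ≃ (A ⟶ D.T.obj Y) := E.adj.homEquiv A Y

/-- Transposition along `Tₙ° ⊣ Tₙ`. -/
def trn (n : ℕ) {A Y : C} : ((E.Ln n).obj A ⟶ Y) ≃ (A ⟶ (D.Tn n).obj Y) :=
  (E.adjn n).homEquiv A Y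

section Mates

variable (A : C)

/-- The mate of the projection. -/
def po : A ⟶ E.L.obj A := ((conjugateEquiv E.adj Adjunction.id).symm D.p).app A

/-- The mate of the projection of the `n`-fold pullback to the base. -/
def bo (n : ℕ) : A ⟶ (E.Ln n).obj A :=
  ((conjugateEquiv (E.adjn n) Adjunction.id).symm (D.b n)).app A

/-- The mates of the pullback projections. -/
def qo (n : ℕ) (j : Fin n) : E.L.obj A ⟶ (E.Ln n).obj A :=
  ((conjugateEquiv (E.adjn n) E.adj).symm (D.q n j)).app A

/-- The mate of the sum. -/
def so : E.L.obj A ⟶ (E.Ln 2).obj A := ((conjugateEquiv (E.adjn 2) E.adj).symm D.s).app A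

/-- The mate of the zero. -/
def zo : E.L.obj A ⟶ A := ((conjugateEquiv Adjunction.id E.adj).symm D.z).app A

/-- The mate of the vertical lift. -/
def lo : E.L.obj (E.L.obj A) ⟶ E.L.obj A :=
  ((conjugateEquiv E.adj (E.adj.comp E.adj)).symm D.l).app A

/-- The mate of the canonical flip. -/
def co : E.L.obj (E.L.obj A) ⟶ E.L.obj (E.L.obj A) :=
  ((conjugateEquiv (E.adj.comp E.adj) (E.adj.comp E.adj)).symm D.c).app A

/-- The mate of an endomorphism of the tangent bundle functor. -/
def no (ν : D.T ⟶ D.T) : E.L.obj A ⟶ E.L.obj A := ((conjugateEquiv E.adj E.adj).symm ν).app A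

end Mates

section Transposition

variable {A A' Y Y' : C}

theorem tr_map_comp (g : A' ⟶ A) (f : E.L.obj A ⟶ Y) : E.tr (E.L.map g ≫ f) = g ≫ E.tr f :=
  E.adj.homEquiv_naturality_left g f

theorem tr_comp (f : E.L.obj A ⟶ Y) (g : Y ⟶ Y') : E.tr (f ≫ g) = E.tr f ≫ D.T.map g :=
  E.adj.homEquiv_naturality_right f g

theorem tr_symm_comp (f : A ⟶ D.T.obj Y) (g : Y ⟶ Y') :
    E.tr.symm f ≫ g = E.tr.symm (f ≫ D.T.map g) :=
  (E.adj.homEquiv_naturality_right_symm f g).symm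

/-- The mate starts at the identity functor, whose adjunction transposes nothing; hence no `tr` on
the left. The same holds for `bo_comp`. -/
theorem po_comp (f : E.L.obj A ⟶ Y) : E.po A ≫ f = E.tr f ≫ D.pA Y := by
  have := E.adj.homEquiv_conjugateEquiv_symm_app_comp Adjunction.id D.p f
  rwa [Adjunction.id_homEquiv_apply] at this

theorem bo_comp (n : ℕ) (f : (E.Ln n).obj A ⟶ Y) : E.bo A n ≫ f = E.trn n f ≫ D.bA Y n := by
  have := (E.adjn n).homEquiv_conjugateEquiv_symm_app_comp Adjunction.id (D.b n) f
  rwa [Adjunction.id_homEquiv_apply] at this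

theorem tr_qo (n : ℕ) (j : Fin n) (f : (E.Ln n).obj A ⟶ Y) :
    E.tr (E.qo A n j ≫ f) = E.trn n f ≫ D.qA Y n j :=
  (E.adjn n).homEquiv_conjugateEquiv_symm_app_comp E.adj (D.q n j) f

theorem tr_so (f : (E.Ln 2).obj A ⟶ Y) : E.tr (E.so A ≫ f) = E.trn 2 f ≫ D.sA Y :=
  (E.adjn 2).homEquiv_conjugateEquiv_symm_app_comp E.adj D.s f

theorem tr_zo (f : A ⟶ Y) : E.tr (E.zo A ≫ f) = f ≫ D.zA Y := by
  have := Adjunction.id.homEquiv_conjugateEquiv_symm_app_comp E.adj D.z (A := A) f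
  rwa [Adjunction.id_homEquiv_apply] at this

theorem tr_tr_lo (f : E.L.obj A ⟶ Y) : E.tr (E.tr (E.lo A ≫ f)) = E.tr f ≫ D.lA Y := by
  have := E.adj.homEquiv_conjugateEquiv_symm_app_comp (E.adj.comp E.adj) D.l f
  rwa [Adjunction.comp_homEquiv] at this

theorem tr_tr_co (f : E.L.obj (E.L.obj A) ⟶ Y) :
    E.tr (E.tr (E.co A ≫ f)) = E.tr (E.tr f) ≫ D.cA Y := by
  have := (E.adj.comp E.adj).homEquiv_conjugateEquiv_symm_app_comp (E.adj.comp E.adj) D.c f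
  rwa [Adjunction.comp_homEquiv] at this

theorem tr_no (ν : D.T ⟶ D.T) (f : E.L.obj A ⟶ Y) :
    E.tr (E.no A ν ≫ f) = E.tr f ≫ ν.app Y :=
  E.adj.homEquiv_conjugateEquiv_symm_app_comp E.adj ν f

theorem zo_nat (f : A ⟶ Y) : E.L.map f ≫ E.zo Y = E.zo A ≫ f :=
  ((conjugateEquiv Adjunction.id E.adj).symm D.z).naturality f

/-- Sums in the dual are sums of transposes. -/
theorem isSum_dual_iff {Y A : Cᵒᵖ} (f g k : Y ⟶ (D.dual E).T.obj A) :
    (D.dual E).IsSum f g k ↔ D.IsSum (E.tr (A := A.unop) f.unop) (E.tr (A := A.unop) g.unop)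
      (E.tr (A := A.unop) k.unop) := by
  constructor
  · rintro ⟨u, rfl, rfl, rfl⟩
    exact ⟨E.trn 2 (A := A.unop) u.unop, (E.tr_qo 2 0 _).symm, (E.tr_qo 2 1 _).symm,
      (E.tr_so _).symm⟩
  · rintro ⟨u, hf, hg, hk⟩
    refine ⟨((E.trn 2).symm u).op, ?_, ?_, ?_⟩ <;> apply Quiver.Hom.unop_inj <;>
      apply (E.tr (A := A.unop)).injective
    · exact (E.tr_qo 2 0 _).trans ((congrArg (· ≫ _) ((E.trn 2).apply_symm_apply u)).trans hf)
    · exact (E.tr_qo 2 1 _).trans ((congrArg (· ≫ _) ((E.trn 2).apply_symm_apply u)).trans hg)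
    · exact (E.tr_so _).trans ((congrArg (· ≫ _) ((E.trn 2).apply_symm_apply u)).trans hk)

/-- The case `k = 𝟙` would suffice, but a general `k` gives composites the form "mate followed by a
map" which the transposition rules rewrite. -/
theorem hom_ext_tr {P : C} {f g : E.L.obj A ⟶ P}
    (h : ∀ {Y : C} (k : P ⟶ Y), E.tr (f ≫ k) = E.tr (g ≫ k)) : f = g := by
  simpa using E.tr.injective (h (𝟙 P))

theorem hom_ext_tr_tr {P : C} {f g : E.L.obj (E.L.obj A) ⟶ P}
    (h : ∀ {Y : C} (k : P ⟶ Y), E.tr (E.tr (f ≫ k)) = E.tr (E.tr (g ≫ k))) : f = g :=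
  E.hom_ext_tr fun k => E.tr.injective (h k)

theorem hom_ext_tr_tr_tr {P : C} {f g : E.L.obj (E.L.obj (E.L.obj A)) ⟶ P}
    (h : ∀ {Y : C} (k : P ⟶ Y), E.tr (E.tr (E.tr (f ≫ k))) = E.tr (E.tr (E.tr (g ≫ k)))) : f = g :=
  E.hom_ext_tr_tr fun k => E.tr.injective (h k)

end Transposition

/-- The adjunction `T° ⊣ T` read in the opposite category. It lets the axioms about all powers of
the dual tangent functor be checked for the power zero only. -/
instance : (D.dual E).T.IsRightAdjoint :=
  E.adj.op.isRightAdjoint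

section

variable (h : D.IsTangent) (A : C)
include h

theorem po_qo (n : ℕ) (j : Fin n) : E.po A ≫ E.qo A n j = E.bo A n := by
  have := E.po_comp (E.qo A n j ≫ 𝟙 _)
  rw [tr_qo, Category.assoc, h.qA_pA, ← E.bo_comp] at this
  simpa using this

variable {A} in
-- A compatible family out of `T°A` transposes to one into `T Y`, which is the same as one map `A ⟶
-- Tₙ Y`, that is, a map `Tₙ°A ⟶ Y`.
theorem exists_unique_desc {Y : C} (n : ℕ) (g : A ⟶ Y)
    (f : Fin n → (E.L.obj A ⟶ Y)) (hf : ∀ j, E.po A ≫ f j = g) :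
    ∃! u : (E.Ln n).obj A ⟶ Y, E.bo A n ≫ u = g ∧ ∀ j, E.qo A n j ≫ u = f j := by
  obtain ⟨u, ⟨hb, hq⟩, hu⟩ := h.exists_unique_lift n g
    (fun j => E.tr (f j)) fun j => (E.po_comp (f j)).symm.trans (hf j)
  refine ⟨(E.trn n).symm u, ⟨?_, fun j => E.tr.injective ?_⟩, ?_⟩
  · rw [bo_comp, Equiv.apply_symm_apply, hb]
  · rw [tr_qo, Equiv.apply_symm_apply, hq]
  · rintro k ⟨hk, hk'⟩
    rw [Equiv.eq_symm_apply]
    refine hu _ ⟨?_, fun j => ?_⟩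
    · rw [← bo_comp, hk]
    · rw [← tr_qo, hk']

variable {A} in
-- `T°` preserves pushouts: transpose once and use the pushout property with target `T Y`.
theorem exists_desc_L {Y : C} (n : ℕ) (g : E.L.obj A ⟶ Y)
    (f : Fin n → (E.L.obj (E.L.obj A) ⟶ Y)) (hf : ∀ j, E.L.map (E.po A) ≫ f j = g) :
    ∃ u : E.L.obj ((E.Ln n).obj A) ⟶ Y, ∀ j, E.L.map (E.qo A n j) ≫ u = f j := by
  obtain ⟨u, ⟨-, hq⟩, -⟩ := E.exists_unique_desc h n (E.tr g)
    (fun j => E.tr (f j)) fun j => by rw [← tr_map_comp, hf]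
  refine ⟨E.tr.symm u, fun j => E.tr.injective ?_⟩
  rw [tr_map_comp, Equiv.apply_symm_apply, hq]

omit h in
theorem isNFoldPullback_dual (h : D.IsTangent) (n : ℕ) (A : Cᵒᵖ) :
    IsNFoldPullback ((D.dual E).p.app A) (((D.dual E).b n).app A)
      (fun j => ((D.dual E).q n j).app A) := by
  rw [isNFoldPullback_iff]
  refine ⟨fun j => Quiver.Hom.unop_inj (E.po_qo h A.unop n j), fun {Y} g f hf => ?_⟩
  obtain ⟨u, ⟨hb, hq⟩, hu⟩ := E.exists_unique_desc h n g.unop (fun j => (f j).unop)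
    fun j => congrArg Quiver.Hom.unop (hf j)
  exact ⟨u.op, ⟨Quiver.Hom.unop_inj hb, fun j => Quiver.Hom.unop_inj (hq j)⟩,
    fun k hk => Quiver.Hom.unop_inj (hu k.unop ⟨congrArg Quiver.Hom.unop hk.1,
      fun j => congrArg Quiver.Hom.unop (hk.2 j)⟩)⟩

theorem po_so : E.po A ≫ E.so A = E.bo A 2 := by
  have := E.po_comp (E.so A ≫ 𝟙 _)
  rw [tr_so, Category.assoc, h.sA_pA, ← E.bo_comp] at this
  simpa using this

theorem po_zo : E.po A ≫ E.zo A = 𝟙 A := by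
  have := E.po_comp (E.zo A ≫ 𝟙 _)
  rw [tr_zo, Category.assoc, h.zA_pA] at this
  simpa using this

/-- Applying `T°` to a mate corresponds to the structure map at `T Y`, and the mate at `T°A` to `T`
of the structure map. Thus the dual of `l_p` needs its flipped form `lA_pA`, and similarly for the
axioms that follow. -/
theorem Lpo_lo : E.L.map (E.po A) ≫ E.lo A = E.zo A ≫ E.po A := by
  refine E.hom_ext_tr fun k => ?_
  rw [Category.assoc, Category.assoc, tr_map_comp, tr_zo, po_comp, po_comp, tr_tr_lo,
    Category.assoc, Category.assoc, h.lA_pA]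

theorem lo_zo : E.lo A ≫ E.zo A = E.L.map (E.zo A) ≫ E.zo A := by
  refine E.hom_ext_tr_tr fun k => ?_
  rw [Category.assoc, Category.assoc, tr_tr_lo, tr_map_comp, tr_zo, tr_zo, Category.assoc,
    Category.assoc, h.zA_lA, D.zA_nat]

theorem po_co : E.po (E.L.obj A) ≫ E.co A = E.L.map (E.po A) := by
  refine E.hom_ext_tr fun k => ?_
  rw [Category.assoc, tr_map_comp, po_comp, tr_comp, tr_tr_co, po_comp, Category.assoc,
    h.cA_Tp]

theorem co_Lzo : E.co A ≫ E.L.map (E.zo A) = E.zo (E.L.obj A) := by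
  refine E.hom_ext_tr_tr fun k => ?_
  rw [Category.assoc, tr_tr_co, tr_map_comp, tr_zo, tr_zo, tr_comp, Category.assoc, h.zA_cA]

theorem co_co : E.co A ≫ E.co A = 𝟙 _ := by
  refine E.hom_ext_tr_tr fun k => ?_
  rw [Category.assoc, tr_tr_co, tr_tr_co, Category.assoc, h.cA_cA, Category.comp_id,
    Category.id_comp]

theorem co_lo : E.co A ≫ E.lo A = E.lo A := by
  refine E.hom_ext_tr_tr fun k => ?_
  rw [Category.assoc, tr_tr_co, tr_tr_lo, Category.assoc, h.lA_cA]

theorem Llo_lo : E.L.map (E.lo A) ≫ E.lo A = E.lo (E.L.obj A) ≫ E.lo A := by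
  refine E.hom_ext_tr_tr_tr fun k => ?_
  rw [Category.assoc, Category.assoc, tr_map_comp, tr_tr_lo, tr_tr_lo, tr_tr_lo, tr_comp,
    tr_tr_lo, Category.assoc, Category.assoc, h.lA_Tl]

omit h in
-- These four rules record the exchange of inner and outer copies on triple transposes. The braid
-- relation for `c` is thereby carried to itself, and the dual of `l_c_c` to `Tl_cA_cA`.
theorem tr_tr_tr_Lco {Y : C} (k : E.L.obj (E.L.obj (E.L.obj A)) ⟶ Y) :
    E.tr (E.tr (E.tr (E.L.map (E.co A) ≫ k))) = E.tr (E.tr (E.tr k)) ≫ D.cA (D.T.obj Y) := by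
  rw [tr_map_comp, tr_tr_co]

omit h in
theorem tr_tr_tr_co {Y : C} (k : E.L.obj (E.L.obj (E.L.obj A)) ⟶ Y) :
    E.tr (E.tr (E.tr (E.co (E.L.obj A) ≫ k))) = E.tr (E.tr (E.tr k)) ≫ D.T.map (D.cA Y) := by
  rw [tr_tr_co, tr_comp]

omit h in
theorem tr_tr_tr_Llo {Y : C} (k : E.L.obj (E.L.obj A) ⟶ Y) :
    E.tr (E.tr (E.tr (E.L.map (E.lo A) ≫ k))) = E.tr (E.tr k) ≫ D.lA (D.T.obj Y) := by
  rw [tr_map_comp, tr_tr_lo]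

omit h in
theorem tr_tr_tr_lo {Y : C} (k : E.L.obj (E.L.obj A) ⟶ Y) :
    E.tr (E.tr (E.tr (E.lo (E.L.obj A) ≫ k))) = E.tr (E.tr k) ≫ D.T.map (D.lA Y) := by
  rw [tr_tr_lo, tr_comp]

theorem co_co_co : E.L.map (E.co A) ≫ E.co (E.L.obj A) ≫ E.L.map (E.co A) =
    E.co (E.L.obj A) ≫ E.L.map (E.co A) ≫ E.co (E.L.obj A) := by
  refine E.hom_ext_tr_tr_tr fun k => ?_
  simp only [Category.assoc, tr_tr_tr_Lco, tr_tr_tr_co, h.cA_cA_cA]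

theorem co_co_lo : E.co (E.L.obj A) ≫ E.L.map (E.co A) ≫ E.lo (E.L.obj A) =
    E.L.map (E.lo A) ≫ E.co A := by
  refine E.hom_ext_tr_tr_tr fun k => ?_
  rw [Category.assoc, Category.assoc, Category.assoc, tr_tr_tr_co, tr_tr_tr_Lco, tr_tr_tr_lo,
    tr_tr_tr_Llo, tr_tr_co, Category.assoc, Category.assoc, Category.assoc, h.Tl_cA_cA]

end

section Sums

variable (h : D.IsTangent)
include h

/-- The map `u` comes from the pushout `T°(T₂°A)`. Its transpose is the pairing from
`exists_lift_lA`, as comparison of the two projections shows, so additivity of `l` at `T Y` gives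
additivity of `l°`. -/
theorem so_lo (A : C) : ∃ u : E.L.obj ((E.Ln 2).obj A) ⟶ (E.Ln 2).obj A,
    (∀ j, E.L.map (E.qo A 2 j) ≫ u = E.lo A ≫ E.qo A 2 j) ∧
      E.lo A ≫ E.so A = E.L.map (E.so A) ≫ u := by
  obtain ⟨u, hu⟩ := E.exists_desc_L h (Y := (E.Ln 2).obj A) 2 (E.zo A ≫ E.bo A 2)
    (fun j => E.lo A ≫ E.qo A 2 j) fun j => by
      rw [← Category.assoc, E.Lpo_lo h, Category.assoc, E.po_qo h]
  refine ⟨u, hu, E.hom_ext_tr_tr fun {Y} k => ?_⟩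
  obtain ⟨v, hv, hs⟩ := h.exists_lift_lA Y
  have e (j) : E.trn 2 (E.tr (u ≫ k)) ≫ D.qA (D.T.obj Y) 2 j =
      E.trn 2 k ≫ v ≫ D.qA (D.T.obj Y) 2 j := by
    rw [← tr_qo, ← tr_map_comp, reassoc_of% (hu j), tr_tr_lo, tr_qo, hv, Category.assoc]
  have e' : E.trn 2 (E.tr (u ≫ k)) = E.trn 2 k ≫ v :=
    h.hom_ext_two ((e 0).trans (Category.assoc _ _ _).symm)
      ((e 1).trans (Category.assoc _ _ _).symm)
  rw [Category.assoc, Category.assoc, tr_tr_lo, tr_map_comp, tr_so, tr_so, e', Category.assoc,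
    Category.assoc, hs]

theorem exists_sum_co (A : C) : ∃ u : E.L.obj A ⟶ (D.Tn 2).obj (E.L.obj ((E.Ln 2).obj A)),
    (∀ j, u ≫ D.qA _ 2 j = E.tr (E.co A ≫ E.L.map (E.qo A 2 j))) ∧
      u ≫ D.sA _ = E.tr (E.co A ≫ E.L.map (E.so A)) := by
  obtain ⟨v, hv, hs⟩ := h.exists_flip_two_inv (E.L.obj ((E.Ln 2).obj A))
  -- The universal element `A ⟶ T₂(T(T°T₂°A))`, the transpose of an identity, is moved to
  -- `T(T₂(T°T₂°A))` by the inverse flip and transposed back once.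
  refine ⟨E.tr.symm (E.trn 2 (E.tr (𝟙 _)) ≫ v), fun j => E.tr.injective ?_, E.tr.injective ?_⟩
  · rw [tr_symm_comp, Equiv.apply_symm_apply, tr_tr_co,
      ← Category.comp_id (E.L.map (E.qo A 2 j)), tr_map_comp, tr_qo, Category.assoc,
      Category.assoc, hv]
  · rw [tr_symm_comp, Equiv.apply_symm_apply, tr_tr_co,
      ← Category.comp_id (E.L.map (E.so A)), tr_map_comp, tr_so, Category.assoc,
      Category.assoc, hs]

/-- The mate of the vertical map `T₂ ⟶ T²`, up to the flip. -/
theorem exists_vertical (A : C) : ∃ u : E.L.obj ((E.Ln 2).obj A) ⟶ (E.Ln 2).obj A,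
    E.L.map (E.qo A 2 0) ≫ u = E.lo A ≫ E.qo A 2 0 ∧
    E.L.map (E.qo A 2 1) ≫ u = E.zo (E.L.obj A) ≫ E.qo A 2 1 ∧
    ∀ {Y : C} (k : (E.Ln 2).obj A ⟶ Y) {w : (D.Tn 2).obj Y ⟶ D.T.obj (D.T.obj Y)},
      D.IsVertical Y w →
        E.tr (E.tr ((E.L.map (E.so A) ≫ u) ≫ k)) = E.trn 2 k ≫ w ≫ D.cA Y := by
  obtain ⟨u, hu⟩ := E.exists_desc_L h (Y := (E.Ln 2).obj A) 2 (E.zo A ≫ E.bo A 2)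
    ![E.lo A ≫ E.qo A 2 0, E.zo (E.L.obj A) ≫ E.qo A 2 1] fun j => by
      fin_cases j
      · change E.L.map (E.po A) ≫ E.lo A ≫ E.qo A 2 0 = _
        rw [← Category.assoc, E.Lpo_lo h, Category.assoc, E.po_qo h]
      · change E.L.map (E.po A) ≫ E.zo (E.L.obj A) ≫ E.qo A 2 1 = _
        rw [← Category.assoc, E.zo_nat, Category.assoc, E.po_qo h]
  have hu0 : E.L.map (E.qo A 2 0) ≫ u = E.lo A ≫ E.qo A 2 0 := hu 0
  have hu1 : E.L.map (E.qo A 2 1) ≫ u = E.zo (E.L.obj A) ≫ E.qo A 2 1 := hu 1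
  refine ⟨u, hu0, hu1, fun {Y} k w hw => ?_⟩
  obtain ⟨v, h0, h1, hv⟩ := h.exists_of_isVertical hw
  have e : E.trn 2 (E.tr (u ≫ k)) = E.trn 2 k ≫ v := by
    apply h.hom_ext_two
    · rw [← tr_qo, ← tr_map_comp, reassoc_of% hu0, tr_tr_lo, tr_qo, Category.assoc, Category.assoc,
        h0]
    · rw [← tr_qo, ← tr_map_comp, reassoc_of% hu1, tr_zo, tr_comp, tr_qo, Category.assoc,
        Category.assoc, h1]
  rw [Category.assoc, tr_map_comp, tr_so, e, Category.assoc, hv]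

/-- Maps `T°T°A ⟶ Y` are maps `A ⟶ T²Y`. After a flip, the coequalizer condition on the former is
the equalizer condition on the latter, so universality of the vertical lift at `Y` gives the
factorization. -/
theorem exists_coequalizer (A : C) : ∃ u : E.L.obj ((E.Ln 2).obj A) ⟶ (E.Ln 2).obj A,
    E.L.map (E.qo A 2 0) ≫ u = E.lo A ≫ E.qo A 2 0 ∧
    E.L.map (E.qo A 2 1) ≫ u = E.zo (E.L.obj A) ≫ E.qo A 2 1 ∧
    E.L.map (E.po A) ≫ E.L.map (E.so A) ≫ u =
      (E.zo A ≫ E.po A ≫ E.L.map (E.po A)) ≫ E.L.map (E.so A) ≫ u ∧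
    ∀ {Y : C} (f : E.L.obj (E.L.obj A) ⟶ Y),
      E.L.map (E.po A) ≫ f = (E.zo A ≫ E.po A ≫ E.L.map (E.po A)) ≫ f →
        ∃! t : (E.Ln 2).obj A ⟶ Y, (E.L.map (E.so A) ≫ u) ≫ t = f := by
  obtain ⟨u, hu0, hu1, hu⟩ := E.exists_vertical h A
  -- `T°(p°)` transposes to `p_{T Y}`, whereas the equalizer concerns `T(p_Y)`; composing with `c`
  -- exchanges the two.
  have key {Y : C} (f : E.L.obj (E.L.obj A) ⟶ Y) :
      E.L.map (E.po A) ≫ f = (E.zo A ≫ E.po A ≫ E.L.map (E.po A)) ≫ f ↔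
        (E.tr (E.tr f) ≫ D.cA Y) ≫ D.T.map (D.pA Y) =
          (E.tr (E.tr f) ≫ D.cA Y) ≫ D.T.map (D.pA Y) ≫ D.pA Y ≫ D.zA Y := by
    have e : E.tr (E.L.map (E.po A) ≫ f) = E.tr (E.tr f) ≫ D.pA (D.T.obj Y) := by
      rw [tr_map_comp, po_comp]
    rw [← E.tr.injective.eq_iff, Category.assoc, Category.assoc, tr_zo, po_comp, e]
    simp only [Category.assoc]
    rw [reassoc_of% (h.cA_Tp Y), h.cA_Tp Y]
  refine ⟨u, hu0, hu1, ?_, fun {Y} f hf => ?_⟩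
  · obtain ⟨w, hw, hw'⟩ := h.universal ((E.Ln 2).obj A)
    have e := ((isEqualizer_iff _ _ _).1 (hw' 0)).1
    change w ≫ D.T.map (D.pA _) = w ≫ D.T.map (D.pA _) ≫ D.pA _ ≫ D.zA _ at e
    -- Evaluated at the universal case `Y = T₂°A`, `k = 𝟙`, where the double transpose factors
    -- through `w`.
    have := (key ((E.L.map (E.so A) ≫ u) ≫ 𝟙 _)).2 (by
      rw [hu (𝟙 _) hw]
      simp only [Category.assoc]
      rw [reassoc_of% (h.cA_cA), reassoc_of% (h.cA_cA), e])
    rwa [Category.comp_id] at this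
  · obtain ⟨w, hw, hw'⟩ := h.universal Y
    obtain ⟨t, ht, ht'⟩ := ((isEqualizer_iff _ _ _).1 (hw' 0)).2 _ ((key f).1 hf)
    change A ⟶ (D.Tn 2).obj Y at t
    replace ht : t ≫ w = E.tr (E.tr f) ≫ D.cA _ := ht
    replace ht' (m : A ⟶ (D.Tn 2).obj Y) (hm : m ≫ w = E.tr (E.tr f) ≫ D.cA _) : m = t := ht' m hm
    refine ⟨(E.trn 2).symm t, E.tr.injective (E.tr.injective ?_), fun m hm => ?_⟩
    · rw [hu _ hw, Equiv.apply_symm_apply, reassoc_of% ht, h.cA_cA, Category.comp_id]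
    · refine (Equiv.eq_symm_apply _).2 (ht' _ ?_)
      rw [← hm, hu m hw, Category.assoc, Category.assoc, h.cA_cA, Category.comp_id]

omit h in
theorem universal_dual (h : D.IsTangent) (A : Cᵒᵖ) : ∃ w, (D.dual E).IsVertical A w ∧
    IsEqualizer w ((D.dual E).T.map ((D.dual E).p.app A))
      ((D.dual E).T.map ((D.dual E).p.app A) ≫ (D.dual E).p.app A ≫ (D.dual E).z.app A) := by
  obtain ⟨u, hu0, hu1, hw, hu⟩ := E.exists_coequalizer h A.unop
  refine ⟨(E.L.map (E.so A.unop) ≫ u).op, ⟨u.op, Quiver.Hom.unop_inj hu0,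
    Quiver.Hom.unop_inj hu1, rfl⟩, (isEqualizer_iff _ _ _).2 ⟨Quiver.Hom.unop_inj ?_,
    fun {W} f hf => ?_⟩⟩
  · exact hw.trans (congrArg (· ≫ _) (Category.assoc _ _ _).symm)
  · obtain ⟨t, ht, ht'⟩ := hu f.unop ((congrArg Quiver.Hom.unop hf).trans
      (congrArg (· ≫ f.unop) (Category.assoc _ _ _)))
    exact ⟨t.op, Quiver.Hom.unop_inj ht,
      fun m hm => Quiver.Hom.unop_inj (ht' m.unop (congrArg Quiver.Hom.unop hm))⟩

omit h in
theorem tr_zo_po {A Y : C} (f : E.L.obj A ⟶ Y) :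
    E.tr ((E.zo A ≫ E.po A) ≫ f) = E.tr f ≫ D.pA Y ≫ D.zA Y := by
  rw [Category.assoc, tr_zo, po_comp, Category.assoc]

omit h in
theorem po_no {ν : D.T ⟶ D.T} (h : D.IsRosicky ν) (A : C) : E.po A ≫ E.no A ν = E.po A := by
  have := E.po_comp (E.no A ν ≫ 𝟙 _)
  rw [tr_no, Category.assoc, pA, h.n_p, ← pA, ← po_comp] at this
  simpa using this

/-- The dual of an adjoint tangent structure is a tangent structure on the opposite category. -/
theorem isTangent_dual : (D.dual E).IsTangent where
  isPullback m n A :=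
    have := isRightAdjoint_iter (D.dual E).T m
    (E.isNFoldPullback_dual h n A).map (iter (D.dual E).T m)
  s_p A := Quiver.Hom.unop_inj (E.po_so h A.unop)
  z_p A := Quiver.Hom.unop_inj (E.po_zo h A.unop)
  sum_assoc h1 h2 h3 := by
    rw [isSum_dual_iff] at h1 h2 h3 ⊢
    exact h.sum_assoc h1 h2 h3
  sum_comm h1 := by
    rw [isSum_dual_iff] at h1 ⊢
    exact h.sum_comm h1
  sum_zero {Y A} f := by
    rw [isSum_dual_iff]
    exact (congrArg (D.IsSum _ · _) (E.tr_zo_po (A := A.unop) f.unop)).mpr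
      (h.sum_zero (E.tr (A := A.unop) f.unop))
  l_p A := Quiver.Hom.unop_inj (E.Lpo_lo h A.unop)
  z_l A := Quiver.Hom.unop_inj (E.lo_zo h A.unop)
  s_l A := by
    obtain ⟨u, hu, hs⟩ := E.so_lo h A.unop
    exact ⟨u.op, fun j => Quiver.Hom.unop_inj (hu j), Quiver.Hom.unop_inj hs⟩
  c_p A := Quiver.Hom.unop_inj (E.po_co h A.unop)
  z_c A := Quiver.Hom.unop_inj (E.co_Lzo h A.unop)
  s_c A := by
    rw [isSum_dual_iff]
    obtain ⟨u, hu, hs⟩ := E.exists_sum_co h A.unop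
    exact ⟨u, hu 0, hu 1, hs⟩
  c_c A := Quiver.Hom.unop_inj (E.co_co h A.unop)
  l_c A := Quiver.Hom.unop_inj (E.co_lo h A.unop)
  l_l A := Quiver.Hom.unop_inj (E.Llo_lo h A.unop)
  c_c_c A := Quiver.Hom.unop_inj <|
    (Category.assoc _ _ _).trans ((E.co_co_co h A.unop).trans (Category.assoc _ _ _).symm)
  l_c_c A := Quiver.Hom.unop_inj <|
    (Category.assoc _ _ _).trans (E.co_co_lo h A.unop)
  universal A := by
    obtain ⟨w, hw, hw'⟩ := E.universal_dual h A
    have := isRightAdjoint_iter (D.dual E).T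
    exact ⟨w, hw, fun m => hw'.map (iter (D.dual E).T m)⟩

omit h in
theorem isRosicky_dual {ν : D.T ⟶ D.T} (h : D.IsRosicky ν) :
    (D.dual E).IsRosicky (D.dualNeg E ν) where
  isTangent := E.isTangent_dual h.isTangent
  n_p A := Quiver.Hom.unop_inj (E.po_no h A.unop)
  n_sum A := by
    rw [isSum_dual_iff]
    obtain ⟨u, h0, h1, h2⟩ := h.n_sum (E.L.obj A.unop)
    have e1 := E.tr_no ν (𝟙 (E.L.obj A.unop))
    have e2 := E.tr_zo_po (𝟙 (E.L.obj A.unop))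
    rw [Category.comp_id] at e1 e2
    -- The unit `A ⟶ T(T°A)` is the universal tangent vector; its sum with its negative is `n_sum`
    -- at `T°A` restricted along it.
    refine ⟨E.tr (𝟙 (E.L.obj A.unop)) ≫ u, ?_, ?_, ?_⟩
    · exact (Category.assoc _ _ _).trans ((congrArg (_ ≫ ·) h0).trans (Category.comp_id _))
    · exact (Category.assoc _ _ _).trans ((congrArg (_ ≫ ·) h1).trans e1.symm)
    · exact (Category.assoc _ _ _).trans ((congrArg (_ ≫ ·) h2).trans e2.symm)

end Sums

/-- Coproducts of `C` are products of `Cᵒᵖ`, and the opposite of `T°` preserves them as a right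
adjoint. -/
theorem isCartesian_dual (h : D.IsTangent) [HasFiniteCoproducts C] : (D.dual E).IsCartesian where
  isTangent := E.isTangent_dual h
  hasFiniteProducts := inferInstance
  preservesFiniteProducts := inferInstance

end Adjoints

end TangentData

namespace CoCartesianDiff

attribute [local instance] hasBinaryBiproducts_of_finite_biproducts
  CategoryTheory.SemiadditiveOfBinaryBiproducts.addCommMonoidHomOfHasBinaryBiproducts

open CategoryTheory.SemiadditiveOfBinaryBiproducts

variable {X : Type u} [Category.{v} X] [HasZeroMorphisms X] [HasFiniteBiproducts X]

/-! ### Powers of an object as biproducts. -/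

section Powers

variable {W A Y : X}

/-- The pairing `⟨f, g₁, …, gₙ⟩`. -/
def powLift {n : ℕ} (f : W ⟶ A) (g : Fin n → (W ⟶ A)) : W ⟶ pow n A :=
  biproduct.lift (Fin.cases f g)

/-- The copairing of `f, g₁, …, gₙ`. -/
def powDesc {n : ℕ} (f : A ⟶ Y) (g : Fin n → (A ⟶ Y)) : pow n A ⟶ Y :=
  biproduct.desc (Fin.cases f g)

/-- The projections of a power. -/
def powπ (n : ℕ) (A : X) (i : Fin (n + 1)) : pow n A ⟶ A := biproduct.π _ i

/-- The injections into a power. -/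
def powι (n : ℕ) (A : X) (i : Fin (n + 1)) : A ⟶ pow n A := biproduct.ι (fun _ => A) i

-- Coordinate `0` is the base point and `j.succ` the `j`-th tangent vector, so the two cases are
-- kept apart throughout.
@[simp] theorem powLift_zero {n : ℕ} (f : W ⟶ A) (g : Fin n → (W ⟶ A)) :
    powLift f g ≫ powπ n A 0 = f := by simp [powLift, powπ]

@[simp] theorem powLift_succ {n : ℕ} (f : W ⟶ A) (g : Fin n → (W ⟶ A)) (j : Fin n) :
    powLift f g ≫ powπ n A j.succ = g j := by simp [powLift, powπ]

@[simp] theorem powDesc_zero {n : ℕ} (f : A ⟶ Y) (g : Fin n → (A ⟶ Y)) :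
    powι n A 0 ≫ powDesc f g = f := by simp [powDesc, powι]

@[simp] theorem powDesc_succ {n : ℕ} (f : A ⟶ Y) (g : Fin n → (A ⟶ Y)) (j : Fin n) :
    powι n A j.succ ≫ powDesc f g = g j := by simp [powDesc, powι]

theorem pow_hom_ext {n : ℕ} {f g : W ⟶ pow n A} (h0 : f ≫ powπ n A 0 = g ≫ powπ n A 0)
    (h : ∀ j : Fin n, f ≫ powπ n A j.succ = g ≫ powπ n A j.succ) : f = g := by
  apply biproduct.hom_ext
  intro i
  cases i using Fin.cases with
  | zero => exact h0
  | succ j => exact h j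

theorem pow_hom_ext' {n : ℕ} {f g : pow n A ⟶ Y} (h0 : powι n A 0 ≫ f = powι n A 0 ≫ g)
    (h : ∀ j : Fin n, powι n A j.succ ≫ f = powι n A j.succ ≫ g) : f = g := by
  apply biproduct.hom_ext'
  intro i
  cases i using Fin.cases with
  | zero => exact h0
  | succ j => exact h j

@[simp] theorem proj_fst (n : ℕ) (j : Fin n) (A : X) : proj n j A ≫ biprod.fst = powπ n A 0 := by
  simp [proj, powπ]

@[simp] theorem proj_snd (n : ℕ) (j : Fin n) (A : X) :
    proj n j A ≫ biprod.snd = powπ n A j.succ := by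
  simp [proj, powπ]

@[simp] theorem inl_inj (n : ℕ) (j : Fin n) (A : X) : biprod.inl ≫ inj n j A = powι n A 0 := by
  simp [inj, powι]

@[simp] theorem inr_inj (n : ℕ) (j : Fin n) (A : X) :
    biprod.inr ≫ inj n j A = powι n A j.succ := by
  simp [inj, powι]

end Powers

section Squares

variable {W A : X}

@[simp] theorem powLift_one (f : W ⟶ A) (g : Fin 2 → (W ⟶ A)) :
    powLift f g ≫ powπ 2 A 1 = g 0 := powLift_succ f g 0

@[simp] theorem powLift_two (f : W ⟶ A) (g : Fin 2 → (W ⟶ A)) :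
    powLift f g ≫ powπ 2 A 2 = g 1 := powLift_succ f g 1

theorem pow_two_hom_ext {f g : W ⟶ pow 2 A} (h0 : f ≫ powπ 2 A 0 = g ≫ powπ 2 A 0)
    (h1 : f ≫ powπ 2 A 1 = g ≫ powπ 2 A 1) (h2 : f ≫ powπ 2 A 2 = g ≫ powπ 2 A 2) : f = g :=
  pow_hom_ext h0 fun j =>
    match j with
    | 0 => h1
    | 1 => h2

end Squares

/-! ### Self-adjointness of the power functors. -/

section SelfAdjoint

/-- `B` is its own left adjoint. -/
def adjB : B X ⊣ B X :=
  Adjunction.mkOfHomEquiv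
    { homEquiv := fun A Y =>
        { toFun := fun f => (biprod.lift (biprod.inl ≫ f) (biprod.inr ≫ f) : A ⟶ Y ⊞ Y)
          invFun := fun g => (biprod.desc (g ≫ biprod.fst) (g ≫ biprod.snd) : A ⊞ A ⟶ Y)
          left_inv := fun f => by
            apply biprod.hom_ext' <;> simp
          right_inv := fun g => by
            apply biprod.hom_ext <;> simp }
      homEquiv_naturality_left_symm := fun {A A' Y} f g => by
        change biprod.desc ((f ≫ g) ≫ biprod.fst) ((f ≫ g) ≫ biprod.snd) =
          biprod.map f f ≫ biprod.desc (g ≫ biprod.fst) (g ≫ biprod.snd)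
        apply biprod.hom_ext' <;> simp
      homEquiv_naturality_right := fun {A Y Y'} f g => by
        change biprod.lift (biprod.inl ≫ f ≫ g) (biprod.inr ≫ f ≫ g) =
          biprod.lift (biprod.inl ≫ f) (biprod.inr ≫ f) ≫ biprod.map g g
        apply biprod.hom_ext <;> simp }

/-- `Bₙ` is its own left adjoint. -/
def adjBn (n : ℕ) : Bn X n ⊣ Bn X n :=
  Adjunction.mkOfHomEquiv
    { homEquiv := fun A Y =>
        { toFun := fun f => (biproduct.lift fun i => biproduct.ι (fun _ => A) i ≫ f : A ⟶ pow n Y)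
          invFun := fun g => (biproduct.desc fun i => g ≫ biproduct.π _ i : pow n A ⟶ Y)
          left_inv := fun f => by
            apply biproduct.hom_ext'
            simp
          right_inv := fun g => by
            apply biproduct.hom_ext
            simp }
      homEquiv_naturality_left_symm := fun {A A' Y} f g => by
        change (biproduct.desc fun i => (f ≫ g) ≫ biproduct.π _ i) =
          (biproduct.map fun _ => f) ≫ biproduct.desc fun i => g ≫ biproduct.π _ i
        apply biproduct.hom_ext'
        simp
      homEquiv_naturality_right := fun {A Y Y'} f g => by
        change (biproduct.lift fun i => biproduct.ι (fun _ => A) i ≫ f ≫ g) =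
          (biproduct.lift fun i => biproduct.ι (fun _ => A) i ≫ f) ≫ biproduct.map fun _ => g
        apply biproduct.hom_ext
        simp }

/-- These two are the input on `X` for lifting left adjoints to algebras. -/
instance : (B X).IsRightAdjoint := adjB.isRightAdjoint

instance (n : ℕ) : (Bn X n).IsRightAdjoint := (adjBn n).isRightAdjoint

instance : (biproductDual X).T.IsRightAdjoint := (adjB (X := X)).op.isRightAdjoint

end SelfAdjoint

/-! ### The tangent structure `𝔹°` on `Xᵒᵖ`. -/

section BiproductDual

variable {A Y : X}

/-- The map `⟨π₁, π₂, π₂⟩`. -/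
def sumB (A : X) : A ⊞ A ⟶ pow 2 A := powLift biprod.fst fun _ => biprod.snd

theorem powι_powπ (n : ℕ) (A : X) (i j : Fin (n + 1)) :
    powι n A i ≫ powπ n A j = if i = j then 𝟙 A else 0 := by
  split_ifs with h
  · subst h
    simp [powι, powπ]
  · exact biproduct.ι_π_ne _ h

@[simp] theorem inj_powπ_zero (n : ℕ) (j : Fin n) (A : X) :
    inj n j A ≫ powπ n A 0 = biprod.fst := by
  apply biprod.hom_ext' <;> rw [← Category.assoc]
  · rw [inl_inj, powι_powπ, if_pos rfl, biprod.inl_fst]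
  · rw [inr_inj, powι_powπ, if_neg (Fin.succ_ne_zero j), biprod.inr_fst]

theorem inj_powπ_succ (n : ℕ) (j : Fin n) (A : X) :
    inj n j A ≫ powπ n A j.succ = biprod.snd := by
  apply biprod.hom_ext' <;> rw [← Category.assoc]
  · rw [inl_inj, powι_powπ, if_neg (Fin.succ_ne_zero j).symm, biprod.inl_snd]
  · rw [inr_inj, powι_powπ, if_pos rfl, biprod.inr_snd]

theorem inj_powπ_succ_ne (n : ℕ) {i j : Fin n} (h : j ≠ i) (A : X) :
    inj n j A ≫ powπ n A i.succ = 0 := by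
  apply biprod.hom_ext' <;> rw [← Category.assoc, comp_zero]
  · rw [inl_inj, powι_powπ, if_neg (Fin.succ_ne_zero i).symm]
  · rw [inr_inj, powι_powπ, if_neg fun e => h (Fin.succ_injective _ e)]

@[simp] theorem inj_zero_one (A : X) : inj 2 0 A ≫ powπ 2 A 1 = biprod.snd := inj_powπ_succ 2 0 A
@[simp] theorem inj_one_two (A : X) : inj 2 1 A ≫ powπ 2 A 2 = biprod.snd := inj_powπ_succ 2 1 A
@[simp] theorem inj_zero_two (A : X) : inj 2 0 A ≫ powπ 2 A 2 = 0 :=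
  inj_powπ_succ_ne 2 (i := 1) (by decide) A
@[simp] theorem inj_one_one (A : X) : inj 2 1 A ≫ powπ 2 A 1 = 0 :=
  inj_powπ_succ_ne 2 (i := 0) (by decide) A

@[simp] theorem lift_id_zero (A : X) : (biprod.lift (𝟙 A) 0 : A ⟶ A ⊞ A) = biprod.inl := by
  apply biprod.hom_ext <;> simp

theorem inl_sumB (A : X) : biprod.inl ≫ sumB A = powι 2 A 0 := by
  apply pow_two_hom_ext <;> rw [powι_powπ]
  · simp [sumB]
  · rw [if_neg (by decide)]
    simp [sumB]
  · rw [if_neg (by decide)]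
    simp [sumB]

theorem inr_sumB (A : X) : biprod.inr ≫ sumB A = powι 2 A 1 + powι 2 A 2 := by
  apply pow_two_hom_ext <;> rw [add_comp, powι_powπ, powι_powπ]
  · rw [if_neg (by decide), if_neg (by decide)]
    simp [sumB]
  · rw [if_pos rfl, if_neg (by decide)]
    simp [sumB]
  · rw [if_neg (by decide), if_pos rfl]
    simp [sumB]

/-- A map out of `A × A` is a base part and a tangent part; addition in `𝔹°` fixes the former and
adds the latter. The monoid axioms thus become those of the hom-monoids. -/
theorem exists_sum_iff (f g k : A ⊞ A ⟶ Y) :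
    (∃ u : pow 2 A ⟶ Y, inj 2 0 A ≫ u = f ∧ inj 2 1 A ≫ u = g ∧ sumB A ≫ u = k) ↔
      biprod.inl ≫ f = biprod.inl ≫ g ∧
      biprod.inl ≫ f = biprod.inl ≫ k ∧ biprod.inr ≫ k = biprod.inr ≫ f + biprod.inr ≫ g := by
  constructor
  · rintro ⟨u, rfl, rfl, rfl⟩
    refine ⟨?_, ?_, ?_⟩
    · rw [← Category.assoc, ← Category.assoc, inl_inj, inl_inj]
    · rw [← Category.assoc, ← Category.assoc, inl_inj, inl_sumB]
    · rw [← Category.assoc, ← Category.assoc, ← Category.assoc, inr_inj, inr_inj, inr_sumB,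
        add_comp]
      rfl
  · rintro ⟨h1, h2, h3⟩
    let u : pow 2 A ⟶ Y := powDesc (biprod.inl ≫ f) ![biprod.inr ≫ f, biprod.inr ≫ g]
    have u0 : powι 2 A 0 ≫ u = biprod.inl ≫ f := powDesc_zero _ _
    have u1 : powι 2 A 1 ≫ u = biprod.inr ≫ f := powDesc_succ _ _ 0
    have u2 : powι 2 A 2 ≫ u = biprod.inr ≫ g := powDesc_succ _ _ 1
    refine ⟨u, ?_, ?_, ?_⟩
    · apply biprod.hom_ext' <;> rw [← Category.assoc]
      · rw [inl_inj, u0]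
      · rw [inr_inj]
        exact u1
    · apply biprod.hom_ext' <;> rw [← Category.assoc]
      · rw [inl_inj, u0, h1]
      · rw [inr_inj]
        exact u2
    · apply biprod.hom_ext' <;> rw [← Category.assoc]
      · rw [inl_sumB, u0, h2]
      · rw [inr_sumB, add_comp, u1, u2, h3]

theorem exists_unique_powDesc (n : ℕ) (g : A ⟶ Y) (f : Fin n → (A ⊞ A ⟶ Y))
    (hf : ∀ j, biprod.lift (𝟙 A) 0 ≫ f j = g) :
    ∃! u : pow n A ⟶ Y, powι n A 0 ≫ u = g ∧ ∀ j, inj n j A ≫ u = f j := by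
  refine ⟨powDesc g fun j => biprod.inr ≫ f j, ⟨powDesc_zero _ _, fun j => ?_⟩, ?_⟩
  · apply biprod.hom_ext' <;> rw [← Category.assoc]
    · rw [inl_inj, powDesc_zero, ← hf j, lift_id_zero]
    · rw [inr_inj, powDesc_succ]
  · rintro k ⟨hk, hk'⟩
    refine pow_hom_ext' (hk.trans (powDesc_zero _ _).symm) fun j => ?_
    rw [powDesc_succ, ← hk' j, ← Category.assoc, inr_inj]

theorem exists_outer_inj (A : X) : ∃ u : pow 2 A ⊞ pow 2 A ⟶ pow 2 A,
    (∀ j, biprod.map (inj 2 j A) (inj 2 j A) ≫ u = outer A ≫ inj 2 j A) ∧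
      outer A ≫ sumB A = biprod.map (sumB A) (sumB A) ≫ u := by
  -- `⟨π₁, π₄⟩` coordinatewise: the base comes from the first factor, both tangent vectors from the
  -- second.
  refine ⟨powLift (biprod.fst ≫ powπ 2 A 0) ![biprod.snd ≫ powπ 2 A 1, biprod.snd ≫ powπ 2 A 2],
    fun j => ?_, ?_⟩
  · match j with
    | 0 => apply pow_two_hom_ext <;> simp [outer]
    | 1 => apply pow_two_hom_ext <;> simp [outer]
  · apply pow_two_hom_ext <;> simp [outer, sumB]

/-- The map `(T²A)° ⟶ A³` of the universality of the vertical lift. -/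
def vertDual (A : X) : (A ⊞ A) ⊞ (A ⊞ A) ⟶ pow 2 A :=
  powLift (biprod.fst ≫ biprod.fst) ![biprod.snd ≫ biprod.snd, biprod.fst ≫ biprod.snd]

theorem exists_vertDual (A : X) : ∃ u : pow 2 A ⊞ pow 2 A ⟶ pow 2 A,
    biprod.map (inj 2 0 A) (inj 2 0 A) ≫ u = outer A ≫ inj 2 0 A ∧
    biprod.map (inj 2 1 A) (inj 2 1 A) ≫ u = biprod.fst ≫ inj 2 1 A ∧
    vertDual A = biprod.map (sumB A) (sumB A) ≫ u := by
  -- The last coordinate is taken from the first factor, because the second summand is governed by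
  -- `z° = π₁` instead of `l°`.
  refine ⟨powLift (biprod.fst ≫ powπ 2 A 0) ![biprod.snd ≫ powπ 2 A 1, biprod.fst ≫ powπ 2 A 2],
    ?_, ?_, ?_⟩
  · apply pow_two_hom_ext <;> simp [outer]
  · apply pow_two_hom_ext <;> simp
  · apply pow_two_hom_ext <;> simp [sumB, vertDual]

theorem vertDual_desc (A : X) :
    biprod.map (biprod.lift (𝟙 A) 0) (biprod.lift (𝟙 A) 0) ≫ vertDual A =
      ((biprod.fst ≫ biprod.lift (𝟙 A) 0) ≫
        biprod.map (biprod.lift (𝟙 A) 0) (biprod.lift (𝟙 A) 0)) ≫ vertDual A := by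
  apply pow_two_hom_ext <;> simp [vertDual]

/-- `vertDual` forgets the third of four coordinates and is split by `r`, which inserts a zero
there. The hypothesis makes `f` vanish on that coordinate, so `f` factors as `vertDual ≫ r ≫ f`. -/
theorem exists_unique_vertDual (f : (A ⊞ A) ⊞ (A ⊞ A) ⟶ Y)
    (hf : biprod.map (biprod.lift (𝟙 A) 0) (biprod.lift (𝟙 A) 0) ≫ f =
      ((biprod.fst ≫ biprod.lift (𝟙 A) 0) ≫
        biprod.map (biprod.lift (𝟙 A) 0) (biprod.lift (𝟙 A) 0)) ≫ f) :
    ∃! t : pow 2 A ⟶ Y, vertDual A ≫ t = f := by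
  let r : pow 2 A ⟶ (A ⊞ A) ⊞ (A ⊞ A) :=
    biprod.lift (biprod.lift (powπ 2 A 0) (powπ 2 A 2)) (biprod.lift 0 (powπ 2 A 1))
  have hr : r ≫ vertDual A = 𝟙 _ := by
    apply pow_two_hom_ext <;> simp [vertDual, r]
  have e : biprod.inl ≫ biprod.inr ≫ f = 0 := by
    have := congrArg (biprod.inr ≫ ·) hf
    simpa using this
  have e0 : biprod.inl ≫ biprod.inl ≫ vertDual A ≫ r = biprod.inl ≫ biprod.inl := by
    ext <;> simp [vertDual, r]
  have e1 : biprod.inr ≫ biprod.inl ≫ vertDual A ≫ r = biprod.inr ≫ biprod.inl := by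
    ext <;> simp [vertDual, r]
  have e2 : biprod.inl ≫ biprod.inr ≫ vertDual A ≫ r = 0 := by
    ext <;> simp [vertDual, r]
  have e3 : biprod.inr ≫ biprod.inr ≫ vertDual A ≫ r = biprod.inr ≫ biprod.inr := by
    ext <;> simp [vertDual, r]
  refine ⟨r ≫ f, ?_, fun m hm => ?_⟩
  · apply biprod.hom_ext' <;> apply biprod.hom_ext'
    · simpa using congrArg (· ≫ f) e0
    · simpa using congrArg (· ≫ f) e1
    · rw [e]
      simpa using congrArg (· ≫ f) e2
    · simpa using congrArg (· ≫ f) e3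
  · rw [← hm, reassoc_of% hr]

theorem isSum_biproductDual_iff {Y A : Xᵒᵖ} (f g k : A.unop ⊞ A.unop ⟶ Y.unop) :
    (biproductDual X).IsSum (Y := Y) (A := A) f.op g.op k.op ↔
      biprod.inl ≫ f = biprod.inl ≫ g ∧
      biprod.inl ≫ f = biprod.inl ≫ k ∧ biprod.inr ≫ k = biprod.inr ≫ f + biprod.inr ≫ g := by
  rw [← exists_sum_iff]
  exact ⟨fun ⟨u, h0, h1, h2⟩ => ⟨u.unop, congrArg Quiver.Hom.unop h0, congrArg Quiver.Hom.unop h1,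
    congrArg Quiver.Hom.unop h2⟩,
  fun ⟨u, h0, h1, h2⟩ => ⟨u.op, Quiver.Hom.unop_inj h0, Quiver.Hom.unop_inj h1,
    Quiver.Hom.unop_inj h2⟩⟩

theorem isNFoldPullback_biproductDual (n : ℕ) (A : Xᵒᵖ) :
    IsNFoldPullback ((biproductDual X).p.app A) (((biproductDual X).b n).app A)
      (fun j => ((biproductDual X).q n j).app A) := by
  rw [isNFoldPullback_iff]
  refine ⟨fun j => Quiver.Hom.unop_inj ?_, fun {Y} g f hf => ?_⟩
  · change biprod.lift (𝟙 A.unop) 0 ≫ inj n j A.unop = powι n A.unop 0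
    rw [lift_id_zero, inl_inj]
  · obtain ⟨u, ⟨hb, hq⟩, hu⟩ := exists_unique_powDesc n g.unop (fun j => (f j).unop)
      fun j => congrArg Quiver.Hom.unop (hf j)
    exact ⟨u.op, ⟨Quiver.Hom.unop_inj hb, fun j => Quiver.Hom.unop_inj (hq j)⟩,
      fun k hk => Quiver.Hom.unop_inj (hu k.unop ⟨congrArg Quiver.Hom.unop hk.1,
        fun j => congrArg Quiver.Hom.unop (hk.2 j)⟩)⟩

theorem universal_biproductDual (A : Xᵒᵖ) : ∃ w, (biproductDual X).IsVertical A w ∧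
    IsEqualizer w ((biproductDual X).T.map ((biproductDual X).p.app A))
      ((biproductDual X).T.map ((biproductDual X).p.app A) ≫ (biproductDual X).p.app A ≫
        (biproductDual X).z.app A) := by
  obtain ⟨u, hu0, hu1, hw⟩ := exists_vertDual A.unop
  refine ⟨(vertDual A.unop).op, ⟨u.op, Quiver.Hom.unop_inj hu0,
    Quiver.Hom.unop_inj hu1, Quiver.Hom.unop_inj hw⟩, (isEqualizer_iff _ _ _).2
    ⟨Quiver.Hom.unop_inj (vertDual_desc A.unop), fun {W} f hf => ?_⟩⟩
  obtain ⟨t, ht, ht'⟩ := exists_unique_vertDual f.unop (congrArg Quiver.Hom.unop hf)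
  exact ⟨t.op, Quiver.Hom.unop_inj ht,
    fun m hm => Quiver.Hom.unop_inj (ht' m.unop (congrArg Quiver.Hom.unop hm))⟩

theorem isTangent_biproductDual : (biproductDual X).IsTangent where
  isPullback m n A :=
    have := isRightAdjoint_iter (biproductDual X).T m
    (isNFoldPullback_biproductDual n A).map (iter (biproductDual X).T m)
  s_p A := Quiver.Hom.unop_inj <| show biprod.lift (𝟙 A.unop) 0 ≫ sumB A.unop = powι 2 A.unop 0 by
    rw [lift_id_zero, inl_sumB]
  z_p A := Quiver.Hom.unop_inj <| show biprod.lift (𝟙 A.unop) 0 ≫ biprod.fst = 𝟙 A.unop by simp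
  sum_assoc {Y A f g h a e r} h1 h2 h3 := by
    obtain ⟨a1, a2, a3⟩ := (isSum_biproductDual_iff f.unop g.unop a.unop).1 h1
    obtain ⟨b1, b2, b3⟩ := (isSum_biproductDual_iff a.unop h.unop r.unop).1 h2
    obtain ⟨c1, c2, c3⟩ := (isSum_biproductDual_iff g.unop h.unop e.unop).1 h3
    refine (isSum_biproductDual_iff f.unop e.unop r.unop).2 ⟨a1.trans c2, a2.trans b2, ?_⟩
    exact b3.trans ((congrArg (· + _) a3).trans ((add_assoc _ _ _).trans
      (congrArg (_ + ·) c3.symm)))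
  sum_comm {Y A f g r} h1 := by
    obtain ⟨a1, a2, a3⟩ := (isSum_biproductDual_iff f.unop g.unop r.unop).1 h1
    exact (isSum_biproductDual_iff g.unop f.unop r.unop).2
      ⟨a1.symm, a1.symm.trans a2, a3.trans (add_comm _ _)⟩
  sum_zero {Y A} f := by
    suffices H : ∀ f : A.unop ⊞ A.unop ⟶ Y.unop,
        biprod.inl ≫ f = biprod.inl ≫ (biprod.fst ≫ biprod.lift (𝟙 A.unop) 0) ≫ f ∧
        biprod.inl ≫ f = biprod.inl ≫ f ∧ biprod.inr ≫ f =
          biprod.inr ≫ f + biprod.inr ≫ (biprod.fst ≫ biprod.lift (𝟙 A.unop) 0) ≫ f from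
      (isSum_biproductDual_iff f.unop
        ((biprod.fst ≫ biprod.lift (𝟙 A.unop) 0) ≫ f.unop) f.unop).2 (H f.unop)
    intro f
    simp
  l_p A := Quiver.Hom.unop_inj <| show biprod.map (biprod.lift (𝟙 A.unop) 0)
      (biprod.lift (𝟙 A.unop) 0) ≫ outer A.unop = biprod.fst ≫ biprod.lift (𝟙 A.unop) 0 by
    ext <;> simp [outer]
  z_l A := Quiver.Hom.unop_inj <| show outer A.unop ≫ biprod.fst =
      biprod.map biprod.fst biprod.fst ≫ biprod.fst by
    simp [outer]
  s_l A := by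
    obtain ⟨u, hu, hs⟩ := exists_outer_inj A.unop
    exact ⟨u.op, fun j => Quiver.Hom.unop_inj (hu j), Quiver.Hom.unop_inj hs⟩
  c_p A := Quiver.Hom.unop_inj <| show biprod.lift (𝟙 (A.unop ⊞ A.unop)) 0 ≫ flipB A.unop =
      biprod.map (biprod.lift (𝟙 A.unop) 0) (biprod.lift (𝟙 A.unop) 0) by
    ext <;> simp [flipB]
  z_c A := Quiver.Hom.unop_inj <| show flipB A.unop ≫ biprod.map biprod.fst biprod.fst =
      biprod.fst by
    ext <;> simp [flipB]
  s_c A := by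
    refine (isSum_biproductDual_iff (Y := .op (pow 2 A.unop ⊞ pow 2 A.unop))
      (A := .op (A.unop ⊞ A.unop)) (flipB A.unop ≫ biprod.map (inj 2 0 A.unop) (inj 2 0 A.unop))
      (flipB A.unop ≫ biprod.map (inj 2 1 A.unop) (inj 2 1 A.unop))
      (flipB A.unop ≫ biprod.map (sumB A.unop) (sumB A.unop))).2 ⟨?_, ?_, ?_⟩
    · apply biprod.hom_ext' <;> apply biprod.hom_ext <;> simp [flipB]
    · apply biprod.hom_ext' <;> apply biprod.hom_ext <;> simp [flipB, inl_sumB]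
    · apply biprod.hom_ext' <;> apply biprod.hom_ext <;>
        simp [flipB, inr_sumB, add_comp, comp_add]
  c_c A := Quiver.Hom.unop_inj <| show flipB A.unop ≫ flipB A.unop = 𝟙 _ by
    ext <;> simp [flipB]
  l_c A := Quiver.Hom.unop_inj <| show flipB A.unop ≫ outer A.unop = outer A.unop by
    ext <;> simp [flipB, outer]
  l_l A := Quiver.Hom.unop_inj <| show biprod.map (outer A.unop) (outer A.unop) ≫ outer A.unop =
      outer (A.unop ⊞ A.unop) ≫ outer A.unop by
    ext <;> simp [outer]
  c_c_c A := Quiver.Hom.unop_inj <| show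
      (biprod.map (flipB A.unop) (flipB A.unop) ≫ flipB (A.unop ⊞ A.unop)) ≫
        biprod.map (flipB A.unop) (flipB A.unop) =
      (flipB (A.unop ⊞ A.unop) ≫ biprod.map (flipB A.unop) (flipB A.unop)) ≫
        flipB (A.unop ⊞ A.unop) by
    apply biprod.hom_ext <;> apply biprod.hom_ext <;> apply biprod.hom_ext <;> simp [flipB]
  l_c_c A := Quiver.Hom.unop_inj <| show
      (flipB (A.unop ⊞ A.unop) ≫ biprod.map (flipB A.unop) (flipB A.unop)) ≫
        outer (A.unop ⊞ A.unop) =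
      biprod.map (outer A.unop) (outer A.unop) ≫ flipB A.unop by
    apply biprod.hom_ext <;> apply biprod.hom_ext <;> simp [flipB, outer]
  universal A := by
    obtain ⟨w, hw, hw'⟩ := universal_biproductDual A
    have := isRightAdjoint_iter (biproductDual X).T
    exact ⟨w, hw, fun m => hw'.map (iter (biproductDual X).T m)⟩

theorem isRosicky_biproductDual [IsAdditive X] :
    (biproductDual X).IsRosicky (biproductDualNeg X) where
  isTangent := isTangent_biproductDual
  n_p A := Quiver.Hom.unop_inj <| show biprod.lift (𝟙 A.unop) 0 ≫ negB A.unop =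
      biprod.lift (𝟙 A.unop) 0 by
    have : negHom (0 : A.unop ⟶ A.unop) = 0 := by
      simpa using add_negHom (0 : A.unop ⟶ A.unop)
    apply biprod.hom_ext <;> simp [negB, comp_negHom, this]
  n_sum A := by
    refine (isSum_biproductDual_iff (Y := .op (A.unop ⊞ A.unop)) (A := A) (𝟙 (A.unop ⊞ A.unop)) (negB A.unop)
      (biprod.fst ≫ biprod.lift (𝟙 A.unop) 0)).2 ⟨?_, ?_, ?_⟩
    · have : negHom (0 : A.unop ⟶ A.unop) = 0 := by
        simpa using add_negHom (0 : A.unop ⟶ A.unop)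
      apply biprod.hom_ext <;> simp [negB, comp_negHom, this]
    · simp
    · apply biprod.hom_ext <;> simp [negB, comp_negHom, add_comp, add_negHom]

theorem isCartesian_biproductDual : (biproductDual X).IsCartesian where
  isTangent := isTangent_biproductDual
  hasFiniteProducts := inferInstance
  preservesFiniteProducts := inferInstance

end BiproductDual

/-! ### Addition and vertical lift on the carriers of algebras. -/

section Vertical

variable {A W : X}

/-- The sum `⟨π₁, π₂ + π₃⟩`. -/
def addB (A : X) : pow 2 A ⟶ A ⊞ A :=
  biprod.lift (powπ 2 A 0) (powπ 2 A 1 + powπ 2 A 2)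

theorem exists_add_iff (f g k : W ⟶ A ⊞ A) :
    (∃ u : W ⟶ pow 2 A, u ≫ proj 2 0 A = f ∧ u ≫ proj 2 1 A = g ∧ u ≫ addB A = k) ↔
      f ≫ biprod.fst = g ≫ biprod.fst ∧ f ≫ biprod.fst = k ≫ biprod.fst ∧
        k ≫ biprod.snd = f ≫ biprod.snd + g ≫ biprod.snd := by
  constructor
  · rintro ⟨u, rfl, rfl, rfl⟩
    simp [addB, comp_add]
  · rintro ⟨h1, h2, h3⟩
    refine ⟨powLift (f ≫ biprod.fst) ![f ≫ biprod.snd, g ≫ biprod.snd], ?_, ?_, ?_⟩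
    · apply biprod.hom_ext <;> simp
    · apply biprod.hom_ext <;> simp [h1]
    · apply biprod.hom_ext
      · simp [addB, h2]
      · simp [addB, h3, comp_add]

theorem exists_unique_powLift (n : ℕ) (g : W ⟶ A) (f : Fin n → (W ⟶ A ⊞ A))
    (hf : ∀ j, f j ≫ biprod.fst = g) :
    ∃! u : W ⟶ pow n A, u ≫ powπ n A 0 = g ∧ ∀ j, u ≫ proj n j A = f j := by
  refine ⟨powLift g fun j => f j ≫ biprod.snd, ⟨powLift_zero _ _, fun j => ?_⟩, ?_⟩
  · apply biprod.hom_ext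
    · rw [Category.assoc, proj_fst, powLift_zero, hf]
    · rw [Category.assoc, proj_snd, powLift_succ]
  · rintro k ⟨hk, hk'⟩
    refine pow_hom_ext (hk.trans (powLift_zero _ _).symm) fun j => ?_
    rw [powLift_succ, ← hk' j, Category.assoc, proj_snd]

/-- The map `A³ ⟶ T²A` of the universality of the vertical lift. -/
def vertA (A : X) : pow 2 A ⟶ (A ⊞ A) ⊞ (A ⊞ A) :=
  biprod.lift (biprod.lift (powπ 2 A 0) (powπ 2 A 2)) (biprod.lift 0 (powπ 2 A 1))

/-- The retraction of `vertA`. -/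
def vertR (A : X) : (A ⊞ A) ⊞ (A ⊞ A) ⟶ pow 2 A :=
  powLift (biprod.fst ≫ biprod.fst) ![biprod.snd ≫ biprod.snd, biprod.fst ≫ biprod.snd]

theorem vertA_vertR (A : X) : vertA A ≫ vertR A = 𝟙 _ := by
  apply pow_two_hom_ext <;> simp [vertA, vertR]

theorem vertA_eq (A : X) : vertA A ≫ biprod.map biprod.fst biprod.fst =
    vertA A ≫ biprod.map biprod.fst biprod.fst ≫ biprod.fst ≫ biprod.lift (𝟙 A) 0 := by
  apply biprod.hom_ext <;> simp [vertA]

/-- The hypothesis kills the third coordinate of `k`, the only one that `vertR` discards. -/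
theorem comp_vertR_vertA (k : W ⟶ (A ⊞ A) ⊞ (A ⊞ A))
    (hk : k ≫ biprod.map biprod.fst biprod.fst =
      k ≫ biprod.map biprod.fst biprod.fst ≫ biprod.fst ≫ biprod.lift (𝟙 A) 0) :
    (k ≫ vertR A) ≫ vertA A = k := by
  have e : k ≫ biprod.snd ≫ biprod.fst = 0 := by
    simpa using congrArg (· ≫ biprod.snd) hk
  apply biprod.hom_ext <;> apply biprod.hom_ext <;> simp [vertA, vertR, e]

/-- Computes the sum from its two summands alone. For algebras, `u` arises abstractly from
preservation of a pullback and need not be made explicit. -/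
theorem comp_map_addB (u : W ⟶ pow 2 A ⊞ pow 2 A) {f g : W ⟶ (A ⊞ A) ⊞ (A ⊞ A)}
    (hf : u ≫ biprod.map (proj 2 0 A) (proj 2 0 A) = f)
    (hg : u ≫ biprod.map (proj 2 1 A) (proj 2 1 A) = g) :
    u ≫ biprod.map (addB A) (addB A) = biprod.lift
      (biprod.lift (f ≫ biprod.fst ≫ biprod.fst)
        (f ≫ biprod.fst ≫ biprod.snd + g ≫ biprod.fst ≫ biprod.snd))
      (biprod.lift (f ≫ biprod.snd ≫ biprod.fst)
        (f ≫ biprod.snd ≫ biprod.snd + g ≫ biprod.snd ≫ biprod.snd)) := by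
  subst hf hg
  apply biprod.hom_ext <;> apply biprod.hom_ext <;> simp [addB, comp_add]

theorem map_addB_of_vert (u : pow 2 A ⟶ pow 2 A ⊞ pow 2 A)
    (h0 : u ≫ biprod.map (proj 2 0 A) (proj 2 0 A) = proj 2 0 A ≫ vert A)
    (h1 : u ≫ biprod.map (proj 2 1 A) (proj 2 1 A) = proj 2 1 A ≫ vert A) :
    addB A ≫ vert A = u ≫ biprod.map (addB A) (addB A) := by
  rw [comp_map_addB u h0 h1]
  apply biprod.hom_ext <;> apply biprod.hom_ext <;> simp [vert, addB]

theorem map_addB_of_vertical (u : pow 2 A ⟶ pow 2 A ⊞ pow 2 A)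
    (h0 : u ≫ biprod.map (proj 2 0 A) (proj 2 0 A) = proj 2 0 A ≫ vert A)
    (h1 : u ≫ biprod.map (proj 2 1 A) (proj 2 1 A) =
      proj 2 1 A ≫ biprod.lift (𝟙 (A ⊞ A)) 0) :
    u ≫ biprod.map (addB A) (addB A) = vertA A := by
  rw [comp_map_addB u h0 h1]
  apply biprod.hom_ext <;> apply biprod.hom_ext <;> simp [vert, vertA]

omit [HasZeroMorphisms X] [HasFiniteBiproducts X] in
-- `w` is a split monomorphism, so compatibility of `k ≫ r` with the algebra structures may be
-- checked after `w`, where it is that of `k`. The retraction `r` is not required to be an algebra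
-- morphism.
theorem map_comp_of_retraction {S : Monad X} {P Q R : X} {a : S.obj P ⟶ P} {b : S.obj Q ⟶ Q}
    {c : S.obj R ⟶ R} {w : Q ⟶ R} {r : R ⟶ Q} (hr : w ≫ r = 𝟙 Q) (hw : S.map w ≫ c = b ≫ w)
    {k : P ⟶ R} (hk : S.map k ≫ c = a ≫ k) (hkr : (k ≫ r) ≫ w = k) :
    S.map (k ≫ r) ≫ b = a ≫ k ≫ r := by
  calc S.map (k ≫ r) ≫ b = S.map (k ≫ r) ≫ (b ≫ w) ≫ r := by
        rw [Category.assoc, hr, Category.comp_id]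
    _ = S.map ((k ≫ r) ≫ w) ≫ c ≫ r := by
        rw [← hw, S.map_comp (k ≫ r) w, Category.assoc, Category.assoc]
    _ = a ≫ k ≫ r := by rw [hkr, ← Category.assoc, hk, Category.assoc]

end Vertical

/-! ### The tangent structure on algebras and its left adjoints. -/

namespace DifferentialCombinator

variable {S : Monad X} (δ : DifferentialCombinator S)

/-- Adjoint lifting: the forgetful functor is monadic and carries `T` strictly to `B`, which has a
left adjoint. -/
theorem isRightAdjoint_tan [HasReflexiveCoequalizers S.Algebra] : δ.tan.IsRightAdjoint :=
  isRightAdjoint_square_lift_monadic δ.tan S.forget S.forget (B X) (Iso.refl _)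

theorem isRightAdjoint_tanN [HasReflexiveCoequalizers S.Algebra] (n : ℕ) :
    (δ.tanN n).IsRightAdjoint :=
  isRightAdjoint_square_lift_monadic (δ.tanN n) S.forget S.forget (Bn X n) (Iso.refl _)

variable {Y M : S.Algebra}

/-- The underlying map of a morphism into a tangent bundle. -/
def tanF (f : Y ⟶ δ.tan.obj M) : Y.A ⟶ M.A ⊞ M.A := f.f

variable {δ} in

/-- To be an algebra morphism into `Tₙ M`, it suffices to look at the projections. -/
theorem hom_tanN (n : ℕ) {P : X} {a : S.obj P ⟶ P} (u : P ⟶ pow n M.A)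
    (h0 : S.map (u ≫ powπ n M.A 0) ≫ M.a = a ≫ u ≫ powπ n M.A 0)
    (h : ∀ j, S.map (u ≫ proj n j M.A) ≫ δ.tanStr M = a ≫ u ≫ proj n j M.A) :
    S.map u ≫ δ.tanStrN n M = a ≫ u := by
  refine pow_hom_ext ?_ fun j => ?_
  · refine (Category.assoc _ _ _).trans ((congrArg (S.map u ≫ ·) (δ.tanStrN_zero n M)).trans ?_)
    rw [← Category.assoc, ← S.map_comp]
    exact h0.trans (Category.assoc _ _ _).symm
  · refine (Category.assoc _ _ _).trans ((congrArg (S.map u ≫ ·) (δ.tanStrN_succ n j M)).trans ?_)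
    have := congrArg (· ≫ biprod.snd) (h j)
    simp only [Category.assoc, tanStr_snd, proj_snd] at this
    rw [← Category.assoc, ← S.map_comp, this, Category.assoc]

/-- The factorization exists uniquely on carriers, and it respects the algebra structures because
its projections do. -/
theorem isNFoldPullback_tangent (n : ℕ) (M : S.Algebra) :
    IsNFoldPullback (δ.tangent.p.app M) ((δ.tangent.b n).app M)
      (fun j => (δ.tangent.q n j).app M) := by
  rw [isNFoldPullback_iff]
  refine ⟨fun j => Monad.Algebra.Hom.ext (proj_fst n j M.A), fun {Y} g f hf => ?_⟩
  obtain ⟨u, ⟨hb, hq⟩, hu⟩ := exists_unique_powLift n g.f (fun j => δ.tanF (f j))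
    fun j => congrArg Monad.Algebra.Hom.f (hf j)
  refine ⟨{ f := u, h := δ.hom_tanN n u ?_ fun j => ?_ }, ⟨Monad.Algebra.Hom.ext hb,
    fun j => Monad.Algebra.Hom.ext (hq j)⟩, fun k hk => Monad.Algebra.Hom.ext (hu k.f
      ⟨congrArg Monad.Algebra.Hom.f hk.1, fun j => congrArg Monad.Algebra.Hom.f (hk.2 j)⟩)⟩
  · rw [hb]
    exact g.h
  · rw [hq]
    exact (f j).h

/-- As a right adjoint, `T` preserves the pullback `T₂ M`, so pairings into `T(T₂ M)` are algebra
morphisms with no computation of its structure map. -/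
theorem exists_lift_T [δ.tan.IsRightAdjoint] (g : Y ⟶ δ.tan.obj M)
    (f : Fin 2 → (Y ⟶ δ.tan.obj (δ.tan.obj M)))
    (hf : ∀ j, f j ≫ δ.tan.map (δ.tangent.p.app M) = g) :
    ∃ u : Y ⟶ δ.tan.obj (δ.tanObjN 2 M),
      ∀ j, u ≫ δ.tan.map ((δ.tangent.q 2 j).app M) = f j := by
  obtain ⟨u, ⟨-, hu⟩, -⟩ :=
    ((isNFoldPullback_iff _ _ _).1 ((δ.isNFoldPullback_tangent 2 M).map δ.tan)).2 g f hf
  exact ⟨u, hu⟩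

theorem isSum_tangent_iff (f g k : Y ⟶ δ.tan.obj M) :
    δ.tangent.IsSum f g k ↔ δ.tanF f ≫ biprod.fst = δ.tanF g ≫ biprod.fst ∧
      δ.tanF f ≫ biprod.fst = δ.tanF k ≫ biprod.fst ∧
        δ.tanF k ≫ biprod.snd = δ.tanF f ≫ biprod.snd + δ.tanF g ≫ biprod.snd := by
  constructor
  · rintro ⟨u, h0, h1, h2⟩
    exact (exists_add_iff _ _ _).1 ⟨u.f, congrArg Monad.Algebra.Hom.f h0,
      congrArg Monad.Algebra.Hom.f h1, congrArg Monad.Algebra.Hom.f h2⟩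
  · intro h
    obtain ⟨u, h0, h1, h2⟩ := (exists_add_iff _ _ _).2 h
    refine ⟨{ f := u, h := δ.hom_tanN 2 u ?_ fun j => ?_ }, Monad.Algebra.Hom.ext h0,
      Monad.Algebra.Hom.ext h1, Monad.Algebra.Hom.ext h2⟩
    · have e : u ≫ powπ 2 M.A 0 = δ.tanF f ≫ biprod.fst := by
        rw [← h0, Category.assoc, proj_fst]
      rw [e]
      exact (f ≫ δ.tangent.p.app M).h
    · match j with
      | 0 =>
        rw [h0]
        exact f.h
      | 1 =>
        rw [h1]
        exact g.h

/-- On carriers the factorization is composition with the retraction `vertR`;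
`map_comp_of_retraction` makes it an algebra morphism. -/
theorem isEqualizer_vertA (w : δ.tanObjN 2 M ⟶ δ.tan.obj (δ.tan.obj M)) (hw : w.f = vertA M.A) :
    IsEqualizer (Y := δ.tan.obj (δ.tan.obj M)) w (δ.tangent.T.map (δ.tangent.p.app M))
      (δ.tangent.T.map (δ.tangent.p.app M) ≫ δ.tangent.p.app M ≫ δ.tangent.z.app M) := by
  refine (isEqualizer_iff _ _ _).2 ⟨Monad.Algebra.Hom.ext ?_, fun {W} k hk => ?_⟩
  · exact (congrArg (· ≫ _) hw).trans ((vertA_eq M.A).trans (congrArg (· ≫ _) hw).symm)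
  · have hkr := comp_vertR_vertA (δ.tanF k) (congrArg Monad.Algebra.Hom.f hk)
    have h : S.map (vertA M.A) ≫ δ.tanStr (δ.tanObj M) = δ.tanStrN 2 M ≫ vertA M.A := by
      have := w.h
      rwa [hw] at this
    refine ⟨{ f := δ.tanF k ≫ vertR M.A, h := ?_ }, Monad.Algebra.Hom.ext ?_, fun m hm => ?_⟩
    · exact map_comp_of_retraction (vertA_vertR M.A) h k.h hkr
    · exact (congrArg (_ ≫ ·) hw).trans hkr
    · apply Monad.Algebra.Hom.ext
      have e : m.f ≫ vertA M.A = δ.tanF k :=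
        (congrArg (m.f ≫ ·) hw).symm.trans (congrArg Monad.Algebra.Hom.f hm)
      change m.f = δ.tanF k ≫ vertR M.A
      rw [← e]
      exact ((Category.assoc _ _ _).trans ((congrArg (m.f ≫ ·) (vertA_vertR M.A)).trans
        (Category.comp_id _))).symm

theorem universal_tangent [δ.tan.IsRightAdjoint] (M : S.Algebra) :
    ∃ w, δ.tangent.IsVertical M w ∧
      IsEqualizer w (δ.tangent.T.map (δ.tangent.p.app M))
        (δ.tangent.T.map (δ.tangent.p.app M) ≫ δ.tangent.p.app M ≫ δ.tangent.z.app M) := by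
  obtain ⟨u, hu⟩ := δ.exists_lift_T (Y := δ.tanObjN 2 M) (M := M)
    ((δ.tangent.b 2).app M ≫ δ.tangent.z.app M)
    ![(δ.tangent.q 2 0).app M ≫ δ.tangent.l.app M,
      (δ.tangent.q 2 1).app M ≫ δ.tangent.z.app (δ.tan.obj M)] (by
    intro j
    apply Monad.Algebra.Hom.ext
    match j with
    | 0 =>
      change (proj 2 0 M.A ≫ vert M.A) ≫ biprod.map biprod.fst biprod.fst =
        powπ 2 M.A 0 ≫ biprod.lift (𝟙 M.A) 0
      apply biprod.hom_ext <;> simp [vert]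
    | 1 =>
      change (proj 2 1 M.A ≫ biprod.lift (𝟙 (M.A ⊞ M.A)) 0) ≫ biprod.map biprod.fst biprod.fst =
        powπ 2 M.A 0 ≫ biprod.lift (𝟙 M.A) 0
      apply biprod.hom_ext <;> simp)
  have hu0 : u.f ≫ biprod.map (proj 2 0 M.A) (proj 2 0 M.A) = proj 2 0 M.A ≫ vert M.A :=
    congrArg Monad.Algebra.Hom.f (hu 0)
  have hu1 : u.f ≫ biprod.map (proj 2 1 M.A) (proj 2 1 M.A) =
      proj 2 1 M.A ≫ biprod.lift (𝟙 (M.A ⊞ M.A)) 0 :=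
    congrArg Monad.Algebra.Hom.f (hu 1)
  exact ⟨u ≫ δ.tangent.T.map (δ.tangent.s.app M), ⟨u, hu 0, hu 1, rfl⟩,
    δ.isEqualizer_vertA _ (map_addB_of_vertical u.f hu0 hu1)⟩

/-- Having a left adjoint is what makes the powers of `T` preserve the limits, and what supplies the
pairings into `T(T₂ M)`. The remaining axioms are identities of matrices on carriers. -/
theorem isTangent_tangent [δ.tan.IsRightAdjoint] : δ.tangent.IsTangent where
  isPullback m n M :=
    have : δ.tangent.T.IsRightAdjoint := ‹δ.tan.IsRightAdjoint›
    have := isRightAdjoint_iter δ.tangent.T m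
    (δ.isNFoldPullback_tangent n M).map (iter δ.tangent.T m)
  s_p M := Monad.Algebra.Hom.ext <| show addB M.A ≫ biprod.fst = powπ 2 M.A 0 by simp [addB]
  z_p M := Monad.Algebra.Hom.ext <| show biprod.lift (𝟙 M.A) 0 ≫ biprod.fst = 𝟙 M.A by simp
  sum_assoc {Y M f g h a e r} h1 h2 h3 := by
    obtain ⟨a1, a2, a3⟩ := (δ.isSum_tangent_iff _ _ _).1 h1
    obtain ⟨b1, b2, b3⟩ := (δ.isSum_tangent_iff _ _ _).1 h2
    obtain ⟨c1, c2, c3⟩ := (δ.isSum_tangent_iff _ _ _).1 h3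
    refine (δ.isSum_tangent_iff _ _ _).2 ⟨a1.trans c2, a2.trans b2, ?_⟩
    rw [b3, a3, c3, add_assoc]
  sum_comm {Y M f g r} h1 := by
    obtain ⟨a1, a2, a3⟩ := (δ.isSum_tangent_iff _ _ _).1 h1
    exact (δ.isSum_tangent_iff _ _ _).2 ⟨a1.symm, a1.symm.trans a2, a3.trans (add_comm _ _)⟩
  sum_zero {Y M} f := by
    refine (δ.isSum_tangent_iff _ _ _).2 ?_
    have e : δ.tanF (f ≫ δ.tangent.p.app M ≫ δ.tangent.z.app M) =
      δ.tanF f ≫ biprod.fst ≫ biprod.lift (𝟙 M.A) 0 := rfl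
    erw [e]
    simp
  l_p M := Monad.Algebra.Hom.ext <| show vert M.A ≫ biprod.map biprod.fst biprod.fst =
      biprod.fst ≫ biprod.lift (𝟙 M.A) 0 by
    ext <;> simp [vert]
  z_l M := Monad.Algebra.Hom.ext <| show biprod.lift (𝟙 M.A) 0 ≫ vert M.A =
      biprod.lift (𝟙 M.A) 0 ≫ biprod.map (biprod.lift (𝟙 M.A) 0) (biprod.lift (𝟙 M.A) 0) by
    ext <;> simp [vert]
  s_l M := by
    obtain ⟨u, hu⟩ := δ.exists_lift_T (Y := δ.tanObjN 2 M) (M := M)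
      ((δ.tangent.b 2).app M ≫ δ.tangent.z.app M)
      (fun j => (δ.tangent.q 2 j).app M ≫ δ.tangent.l.app M) (by
      intro j
      apply Monad.Algebra.Hom.ext
      change (proj 2 j M.A ≫ vert M.A) ≫ biprod.map biprod.fst biprod.fst =
        powπ 2 M.A 0 ≫ biprod.lift (𝟙 M.A) 0
      apply biprod.hom_ext <;> simp [vert])
    refine ⟨u, hu, Monad.Algebra.Hom.ext ?_⟩
    exact map_addB_of_vert u.f (congrArg Monad.Algebra.Hom.f (hu 0))
      (congrArg Monad.Algebra.Hom.f (hu 1))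
  c_p M := Monad.Algebra.Hom.ext <| show flipB M.A ≫ biprod.fst =
      biprod.map biprod.fst biprod.fst by
    simp [flipB]
  z_c M := Monad.Algebra.Hom.ext <| show
      biprod.map (biprod.lift (𝟙 M.A) 0) (biprod.lift (𝟙 M.A) 0) ≫ flipB M.A =
      biprod.lift (𝟙 (M.A ⊞ M.A)) 0 by
    ext <;> simp [flipB]
  s_c M := by
    refine (δ.isSum_tangent_iff (M := δ.tan.obj M) _ _ _).2 ?_
    suffices H : ∀ q0 q1 s : (pow 2 M.A ⊞ pow 2 M.A) ⟶ (M.A ⊞ M.A) ⊞ (M.A ⊞ M.A),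
        q0 = biprod.map (proj 2 0 M.A) (proj 2 0 M.A) ≫ flipB M.A →
        q1 = biprod.map (proj 2 1 M.A) (proj 2 1 M.A) ≫ flipB M.A →
        s = biprod.map (addB M.A) (addB M.A) ≫ flipB M.A →
        q0 ≫ biprod.fst = q1 ≫ biprod.fst ∧ q0 ≫ biprod.fst = s ≫ biprod.fst ∧
          s ≫ biprod.snd = q0 ≫ biprod.snd + q1 ≫ biprod.snd from H _ _ _ rfl rfl rfl
    rintro _ _ _ rfl rfl rfl
    refine ⟨?_, ?_, ?_⟩ <;> apply biprod.hom_ext <;> simp [flipB, addB, add_comp, comp_add]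
  c_c M := Monad.Algebra.Hom.ext <| show flipB M.A ≫ flipB M.A = 𝟙 _ by
    ext <;> simp [flipB]
  l_c M := Monad.Algebra.Hom.ext <| show vert M.A ≫ flipB M.A = vert M.A by
    ext <;> simp [flipB, vert]
  l_l M := Monad.Algebra.Hom.ext <| show vert M.A ≫ biprod.map (vert M.A) (vert M.A) =
      vert M.A ≫ vert (M.A ⊞ M.A) by
    apply biprod.hom_ext <;> apply biprod.hom_ext <;> apply biprod.hom_ext <;> simp [vert]
  c_c_c M := Monad.Algebra.Hom.ext <| show
      biprod.map (flipB M.A) (flipB M.A) ≫ flipB (M.A ⊞ M.A) ≫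
        biprod.map (flipB M.A) (flipB M.A) =
      flipB (M.A ⊞ M.A) ≫ biprod.map (flipB M.A) (flipB M.A) ≫ flipB (M.A ⊞ M.A) by
    apply biprod.hom_ext <;> apply biprod.hom_ext <;> apply biprod.hom_ext <;> simp [flipB]
  l_c_c M := Monad.Algebra.Hom.ext <| show
      vert (M.A ⊞ M.A) ≫ biprod.map (flipB M.A) (flipB M.A) ≫ flipB (M.A ⊞ M.A) =
      flipB M.A ≫ biprod.map (vert M.A) (vert M.A) by
    apply biprod.hom_ext <;> apply biprod.hom_ext <;> apply biprod.hom_ext <;>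
      simp [flipB, vert]
  universal M := by
    obtain ⟨w, hw, hw'⟩ := δ.universal_tangent M
    have : δ.tangent.T.IsRightAdjoint := ‹δ.tan.IsRightAdjoint›
    have := isRightAdjoint_iter δ.tangent.T
    exact ⟨w, hw, fun m => hw'.map (iter δ.tangent.T m)⟩

theorem isRosicky_tangent [δ.tan.IsRightAdjoint] [IsAdditive X] :
    δ.tangent.IsRosicky δ.tangentNeg where
  isTangent := δ.isTangent_tangent
  n_p M := Monad.Algebra.Hom.ext <| show negB M.A ≫ biprod.fst = biprod.fst by simp [negB]
  n_sum M := by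
    refine (δ.isSum_tangent_iff _ _ _).2 ?_
    change 𝟙 (M.A ⊞ M.A) ≫ biprod.fst = negB M.A ≫ biprod.fst ∧
      𝟙 (M.A ⊞ M.A) ≫ biprod.fst = (biprod.fst ≫ biprod.lift (𝟙 M.A) 0) ≫ biprod.fst ∧
      (biprod.fst ≫ biprod.lift (𝟙 M.A) 0) ≫ biprod.snd =
        𝟙 (M.A ⊞ M.A) ≫ biprod.snd + negB M.A ≫ biprod.snd
    simp [negB, add_negHom]

end DifferentialCombinator

/-! ### Matrix identities behind the compatibility of `τ`. -/

section Matrices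

variable {A P Q : X}

theorem map_comp_map (f : A ⟶ P) (g : P ⟶ Q) :
    biprod.map f f ≫ biprod.map g g = biprod.map (f ≫ g) (f ≫ g) := by
  apply biprod.hom_ext <;> simp

theorem lift_comp_map (f g : A ⟶ P) (h : P ⟶ Q) :
    biprod.lift f g ≫ biprod.map h h = biprod.lift (f ≫ h) (g ≫ h) := by
  apply biprod.hom_ext <;> simp

/-- `vert` and `outer` are mates under the self-adjunction of `A ↦ A × A`. In `lift_comp_flipB` and
`lift_comp_negB`, `flipB` and `negB` are likewise their own mates. -/
theorem lift_comp_vert (t : A ⊞ A ⟶ P) :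
    biprod.lift (biprod.inl ≫ t) (biprod.inr ≫ t) ≫ vert P =
      biprod.lift (biprod.lift (biprod.inl ≫ biprod.inl ≫ outer A ≫ t)
        (biprod.inl ≫ biprod.inr ≫ outer A ≫ t)) (biprod.lift
        (biprod.inr ≫ biprod.inl ≫ outer A ≫ t) (biprod.inr ≫ biprod.inr ≫ outer A ≫ t)) := by
  have e0 : biprod.inl ≫ biprod.inl ≫ outer A = biprod.inl := by ext <;> simp [outer]
  have e1 : biprod.inl ≫ biprod.inr ≫ outer A = 0 := by ext <;> simp [outer]
  have e2 : biprod.inr ≫ biprod.inl ≫ outer A = 0 := by ext <;> simp [outer]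
  have e3 : biprod.inr ≫ biprod.inr ≫ outer A = biprod.inr := by ext <;> simp [outer]
  rw [reassoc_of% e0, reassoc_of% e1, reassoc_of% e2, reassoc_of% e3]
  apply biprod.hom_ext <;> apply biprod.hom_ext <;> simp [vert]

theorem lift_comp_flipB (t : (A ⊞ A) ⊞ (A ⊞ A) ⟶ P) :
    biprod.lift (biprod.lift (biprod.inl ≫ biprod.inl ≫ t) (biprod.inl ≫ biprod.inr ≫ t))
        (biprod.lift (biprod.inr ≫ biprod.inl ≫ t) (biprod.inr ≫ biprod.inr ≫ t)) ≫ flipB P =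
      biprod.lift (biprod.lift (biprod.inl ≫ biprod.inl ≫ flipB A ≫ t)
        (biprod.inl ≫ biprod.inr ≫ flipB A ≫ t)) (biprod.lift
        (biprod.inr ≫ biprod.inl ≫ flipB A ≫ t) (biprod.inr ≫ biprod.inr ≫ flipB A ≫ t)) := by
  have e0 : biprod.inl ≫ biprod.inl ≫ flipB A = biprod.inl ≫ biprod.inl := by
    ext <;> simp [flipB]
  have e1 : biprod.inl ≫ biprod.inr ≫ flipB A = biprod.inr ≫ biprod.inl := by
    ext <;> simp [flipB]
  have e2 : biprod.inr ≫ biprod.inl ≫ flipB A = biprod.inl ≫ biprod.inr := by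
    ext <;> simp [flipB]
  have e3 : biprod.inr ≫ biprod.inr ≫ flipB A = biprod.inr ≫ biprod.inr := by
    ext <;> simp [flipB]
  rw [reassoc_of% e0, reassoc_of% e1, reassoc_of% e2, reassoc_of% e3]
  apply biprod.hom_ext <;> apply biprod.hom_ext <;> simp [flipB]

theorem lift_comp_negB [IsAdditive X] (t : A ⊞ A ⟶ P) :
    biprod.lift (biprod.inl ≫ t) (biprod.inr ≫ t) ≫ negB P =
      biprod.lift (biprod.inl ≫ negB A ≫ t) (biprod.inr ≫ negB A ≫ t) := by
  have h0 : negHom (0 : A ⟶ A) = 0 := by simpa using add_negHom (0 : A ⟶ A)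
  have e1 : biprod.inl ≫ negB A = biprod.inl := by
    apply biprod.hom_ext <;> simp [negB, comp_negHom, h0]
  have e2 : biprod.inr ≫ negB A = negHom biprod.inr := by
    apply biprod.hom_ext <;> simp [negB, comp_negHom, negHom_comp, h0]
  rw [reassoc_of% e1, reassoc_of% e2]
  apply biprod.hom_ext <;> simp [negB, comp_negHom, negHom_comp]

end Matrices

namespace DifferentialCombinator

variable {S : Monad X}

/-! ### Morphisms out of free algebras. -/

section Free

variable {A A' : X} {Y Y' M : S.Algebra}

/-- Morphisms out of a free algebra, as morphisms out of the generators. -/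
def gen : (S.free.obj A ⟶ Y) ≃ (A ⟶ Y.A) := S.adj.homEquiv A Y

omit [HasZeroMorphisms X] [HasFiniteBiproducts X] in
theorem gen_apply (g : S.free.obj A ⟶ Y) : gen g = S.η.app A ≫ g.f := by
  refine (S.adj.homEquiv_unit (X := A) (Y := Y) (f := g)).trans ?_
  simp
  rfl

omit [HasZeroMorphisms X] [HasFiniteBiproducts X] in
theorem gen_map_comp (f : A' ⟶ A) (g : S.free.obj A ⟶ Y) : gen (S.free.map f ≫ g) = f ≫ gen g :=
  S.adj.homEquiv_naturality_left f g

omit [HasZeroMorphisms X] [HasFiniteBiproducts X] in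
theorem gen_comp (g : S.free.obj A ⟶ Y) (k : Y ⟶ Y') : gen (g ≫ k) = gen g ≫ k.f :=
  S.adj.homEquiv_naturality_right g k

variable (δ : DifferentialCombinator S)

/-- On a free algebra a sum may be checked on generators: any map `A ⟶ M ^ 3` in `X` extends to an
algebra morphism into `T₂ M`. -/
theorem isSum_of_gen (f g k : S.free.obj A ⟶ δ.tan.obj M) (f' g' k' : A ⟶ M.A ⊞ M.A)
    (hf : gen f = f') (hg : gen g = g') (hk : gen k = k')
    (h : f' ≫ biprod.fst = g' ≫ biprod.fst ∧ f' ≫ biprod.fst = k' ≫ biprod.fst ∧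
      k' ≫ biprod.snd = f' ≫ biprod.snd + g' ≫ biprod.snd) :
    δ.tangent.IsSum f g k := by
  obtain ⟨u, h0, h1, h2⟩ := (exists_add_iff _ _ _).2 h
  let t : S.free.obj A ⟶ δ.tanObjN 2 M := gen.symm u
  have ht : gen t = u := gen.apply_symm_apply _
  refine ⟨t, gen.injective ?_, gen.injective ?_, gen.injective ?_⟩
  · exact (gen_comp t _).trans ((congrArg (· ≫ proj 2 0 M.A) ht).trans (h0.trans hf.symm))
  · exact (gen_comp t _).trans ((congrArg (· ≫ proj 2 1 M.A) ht).trans (h1.trans hg.symm))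
  · exact (gen_comp t _).trans ((congrArg (· ≫ addB M.A) ht).trans (h2.trans hk.symm))

end Free

/-! ### The comparison `τ : T°F ≅ F𝔹`. -/

section Tau

variable (δ : DifferentialCombinator S) (E : δ.tangent.Adjoints) {A A' : X} {Y : S.Algebra}

/-- Morphisms `T° F(A) ⟶ Y`, as morphisms `A ⟶ Y × Y`. -/
def ev : (E.L.obj (S.free.obj A) ⟶ Y) ≃ (A ⟶ Y.A ⊞ Y.A) :=
  E.tr.trans (gen (Y := δ.tan.obj Y))

theorem ev_apply (h : E.L.obj (S.free.obj A) ⟶ Y) :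
    δ.ev E h = gen (Y := δ.tan.obj Y) (E.tr h) := rfl

/-- Morphisms `T° T° F(A) ⟶ Y`, as morphisms `A ⟶ Y × Y × Y × Y`. -/
def ev₂ : (E.L.obj (E.L.obj (S.free.obj A)) ⟶ Y) ≃ (A ⟶ (Y.A ⊞ Y.A) ⊞ (Y.A ⊞ Y.A)) :=
  E.tr.trans (δ.ev E (Y := δ.tan.obj Y))

theorem eta_lam (A : X) : S.η.app (A ⊞ A) ≫ δ.lam A = biprod.map (S.η.app A) (S.η.app A) := by
  have h := S.η.naturality (biprod.fst : A ⊞ A ⟶ A)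
  simp only [Functor.id_map] at h
  apply biprod.hom_ext
  · simp [lam, ← h]
  · simp [lam, δ.eta_lam']

theorem gen_lamHom_comp (g : S.free.obj A ⟶ Y) :
    gen (δ.lamHom A ≫ δ.tan.map g) = biprod.map (gen g) (gen g) := by
  rw [gen_comp, gen_apply, gen_apply]
  change (S.η.app (A ⊞ A) ≫ δ.lam A) ≫ biprod.map g.f g.f = _
  rw [eta_lam]
  exact map_comp_map _ _

/-- The counit transposes to the identity, so only the map `F(A) ⟶ T F(A × A)` of the defining
formula survives. -/
theorem tr_tau (A : X) : E.tr (δ.tau E A) = S.free.map (unitB A) ≫ δ.lamHom (A ⊞ A) := by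
  have h : E.tr (E.adj.counit.app (S.free.obj (A ⊞ A))) = 𝟙 _ := by
    simp [TangentData.Adjoints.tr, Adjunction.homEquiv_unit]
  rw [tau]
  erw [E.tr_map_comp, E.tr_map_comp, h, Category.comp_id]
  rfl

/-- This identifies `τ` up to Yoneda. On generators `λ` is the identity matrix by `eta_lam`, and
`unitB` is the pair of the two injections, so `g` gets restricted to the two copies of `A`. -/
theorem ev_tau_comp (g : S.free.obj (A ⊞ A) ⟶ Y) :
    δ.ev E (δ.tau E A ≫ g) = biprod.lift (biprod.inl ≫ gen g) (biprod.inr ≫ gen g) := by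
  have h : E.tr (δ.tau E A ≫ g) = S.free.map (unitB A) ≫ δ.lamHom (A ⊞ A) ≫ δ.tan.map g :=
    (E.tr_comp _ _).trans ((congrArg (· ≫ _) (δ.tr_tau E A)).trans (Category.assoc _ _ _))
  rw [ev_apply, h, gen_map_comp, gen_lamHom_comp]
  have h1 : (biprod.lift (𝟙 A) 0 : A ⟶ A ⊞ A) = biprod.inl := by
    apply biprod.hom_ext <;> simp
  have h2 : (biprod.lift 0 (𝟙 A) : A ⟶ A ⊞ A) = biprod.inr := by
    apply biprod.hom_ext <;> simp
  rw [unitB, h1, h2]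
  exact lift_comp_map _ _ _

theorem ev_map_comp (f : A' ⟶ A) (h : E.L.obj (S.free.obj A) ⟶ Y) :
    δ.ev E (E.L.map (S.free.map f) ≫ h) = f ≫ δ.ev E h := by
  exact (congrArg gen (E.tr_map_comp _ _)).trans (gen_map_comp _ _)

theorem ev_ext {P : S.Algebra} {a b : E.L.obj (S.free.obj A) ⟶ P}
    (h : ∀ {Y : S.Algebra} (k : P ⟶ Y), δ.ev E (a ≫ k) = δ.ev E (b ≫ k)) : a = b := by
  simpa using (δ.ev E).injective (h (𝟙 P))

theorem ev₂_ext {P : S.Algebra} {a b : E.L.obj (E.L.obj (S.free.obj A)) ⟶ P}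
    (h : ∀ {Y : S.Algebra} (k : P ⟶ Y), δ.ev₂ E (a ≫ k) = δ.ev₂ E (b ≫ k)) : a = b := by
  simpa using (δ.ev₂ E).injective (h (𝟙 P))

/-- By Yoneda: a map `A ⟶ Y × Y` is the pair of restrictions of a unique map `A × A ⟶ Y`. -/
theorem isIso_tau (A : X) : IsIso (δ.tau E A) := by
  rw [isIso_iff_coyoneda_map_bijective]
  intro Y
  constructor
  · intro g g' h
    have e := congrArg (δ.ev E) h
    simp only [] at e
    erw [ev_tau_comp, ev_tau_comp] at e
    apply gen.injective
    apply biprod.hom_ext'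
    · simpa using congrArg (· ≫ biprod.fst) e
    · simpa using congrArg (· ≫ biprod.snd) e
  · intro h
    refine ⟨gen.symm (biprod.desc (δ.ev E h ≫ biprod.fst) (δ.ev E h ≫ biprod.snd)),
      (δ.ev E).injective ?_⟩
    refine (δ.ev_tau_comp E _).trans ?_
    rw [Equiv.apply_symm_apply]
    apply biprod.hom_ext <;> simp

theorem tau_nat (f : A ⟶ A') : E.L.map (S.free.map f) ≫ δ.tau E A' =
    δ.tau E A ≫ S.free.map (biprod.map f f) := by
  refine δ.ev_ext E fun {Y} k => ?_
  have h := δ.ev_map_comp E f (δ.tau E A' ≫ k)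
  have h' := δ.ev_tau_comp E (S.free.map (biprod.map f f) ≫ k)
  rw [ev_tau_comp] at h
  rw [gen_map_comp] at h'
  refine (congrArg _ (Category.assoc _ _ _)).trans (h.trans ?_)
  refine Eq.trans ?_ ((congrArg _ (Category.assoc _ _ _)).trans h').symm
  apply biprod.hom_ext <;> simp

/-- The isomorphism `T° F ≅ F 𝔹`. -/
def tauIso : S.free ⋙ E.L ≅ B X ⋙ S.free :=
  NatIso.ofComponents (fun A => haveI := δ.isIso_tau E A; asIso (δ.tau E A))
    (fun f => δ.tau_nat E f)

theorem ev_tau_map (A : X) {P : X} (f : A ⊞ A ⟶ P) :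
    δ.ev E (δ.tau E A ≫ S.free.map f) =
      biprod.lift (biprod.inl ≫ f ≫ S.η.app P) (biprod.inr ≫ f ≫ S.η.app P) := by
  have h : gen (S.free.map f) = f ≫ S.η.app P := by
    have h1 : gen (𝟙 (S.free.obj P)) = S.η.app P :=
      (gen_apply (𝟙 (S.free.obj P))).trans (Category.comp_id _)
    rw [← Category.comp_id (S.free.map f), gen_map_comp, h1]
    rfl
  rw [← h]
  exact δ.ev_tau_comp E _

/-- In these rules a transposition rule followed by `gen_comp` turns each mate into a matrix acting
on the carrier of `Y`. -/
theorem gen_po_comp (h : E.L.obj (S.free.obj A) ⟶ Y) :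
    gen (E.po (S.free.obj A) ≫ h) = δ.ev E h ≫ biprod.fst := by
  rw [E.po_comp]
  exact gen_comp _ _

theorem ev_zo_comp (g : S.free.obj A ⟶ Y) :
    δ.ev E (E.zo (S.free.obj A) ≫ g) = gen g ≫ biprod.lift (𝟙 Y.A) 0 :=
  (congrArg gen (E.tr_zo g)).trans (gen_comp _ _)

theorem ev₂_lo_comp (h : E.L.obj (S.free.obj A) ⟶ Y) :
    δ.ev₂ E (E.lo (S.free.obj A) ≫ h) = δ.ev E h ≫ vert Y.A :=
  (congrArg gen (E.tr_tr_lo h)).trans (gen_comp _ _)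

theorem ev₂_co_comp (h : E.L.obj (E.L.obj (S.free.obj A)) ⟶ Y) :
    δ.ev₂ E (E.co (S.free.obj A) ≫ h) = δ.ev₂ E h ≫ flipB Y.A :=
  (congrArg gen (E.tr_tr_co h)).trans (gen_comp _ _)

theorem ev_no_comp [IsAdditive X] (h : E.L.obj (S.free.obj A) ⟶ Y) :
    δ.ev E (E.no (S.free.obj A) δ.tangentNeg ≫ h) = δ.ev E h ≫ negB Y.A :=
  (congrArg gen (E.tr_no δ.tangentNeg h)).trans (gen_comp _ _)

/-- The formula for `τ` applied with target `T Y` and the transpose of `k`. -/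
theorem ev₂_map_tau_comp (k : E.L.obj (S.free.obj (A ⊞ A)) ⟶ Y) :
    δ.ev₂ E (E.L.map (δ.tau E A) ≫ k) =
      biprod.lift (biprod.inl ≫ δ.ev E k) (biprod.inr ≫ δ.ev E k) :=
  (congrArg (δ.ev E (Y := δ.tan.obj Y)) (E.tr_map_comp _ _)).trans
    (δ.ev_tau_comp E (Y := δ.tan.obj Y) (E.tr k))

theorem ev₂_map_tau_tau_comp (g : S.free.obj ((A ⊞ A) ⊞ (A ⊞ A)) ⟶ Y) :
    δ.ev₂ E (E.L.map (δ.tau E A) ≫ δ.tau E (A ⊞ A) ≫ g) =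
      biprod.lift (biprod.lift (biprod.inl ≫ biprod.inl ≫ gen g)
        (biprod.inl ≫ biprod.inr ≫ gen g)) (biprod.lift (biprod.inr ≫ biprod.inl ≫ gen g)
        (biprod.inr ≫ biprod.inr ≫ gen g)) := by
  refine (δ.ev₂_map_tau_comp E _).trans ?_
  rw [ev_tau_comp]
  apply biprod.hom_ext <;> apply biprod.hom_ext <;> simp

theorem po_tau (A : X) :
    E.po (S.free.obj A) ≫ δ.tau E A = S.free.map (biprod.lift (𝟙 A) 0) := by
  apply gen.injective
  refine (δ.gen_po_comp E (δ.tau E A)).trans ?_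
  have h := δ.ev_tau_comp E (𝟙 (S.free.obj (A ⊞ A)))
  rw [← Category.comp_id (S.free.map _), gen_map_comp]
  refine (congrArg (fun t => δ.ev E t ≫ biprod.fst) (Category.comp_id _)).symm.trans ?_
  refine (congrArg (· ≫ biprod.fst) h).trans ?_
  simp

theorem tau_zo (A : X) : δ.tau E A ≫ S.free.map biprod.fst = E.zo (S.free.obj A) := by
  refine δ.ev_ext E fun {Y} k => ?_
  refine (congrArg _ (Category.assoc _ _ _)).trans ((δ.ev_tau_comp E _).trans ?_)
  rw [ev_zo_comp, gen_map_comp]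
  apply biprod.hom_ext <;> simp

/-- Evaluated on generators against any map out of the target, the two sides become those of
`lift_comp_vert`. The same scheme proves `co_tau` and `no_tau` from their matrix identities. -/
theorem lo_tau (A : X) : E.lo (S.free.obj A) ≫ δ.tau E A =
    (E.L.map (δ.tau E A) ≫ δ.tau E (A ⊞ A)) ≫ S.free.map (outer A) := by
  refine δ.ev₂_ext E fun {Y} k => ?_
  have h1 := δ.ev₂_lo_comp E (δ.tau E A ≫ k)
  rw [ev_tau_comp] at h1
  have h2 := δ.ev₂_map_tau_tau_comp E (S.free.map (outer A) ≫ k)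
  rw [gen_map_comp] at h2
  refine (congrArg _ (Category.assoc _ _ _)).trans (h1.trans (Eq.trans ?_
    ((congrArg _ ((Category.assoc _ _ _).trans (Category.assoc _ _ _))).trans h2).symm))
  exact lift_comp_vert _

theorem co_tau (A : X) :
    (E.co (S.free.obj A) ≫ E.L.map (δ.tau E A)) ≫ δ.tau E (A ⊞ A) =
      (E.L.map (δ.tau E A) ≫ δ.tau E (A ⊞ A)) ≫ S.free.map (flipB A) := by
  refine δ.ev₂_ext E fun {Y} k => ?_
  have h1 := δ.ev₂_co_comp E (E.L.map (δ.tau E A) ≫ δ.tau E (A ⊞ A) ≫ k)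
  rw [ev₂_map_tau_tau_comp] at h1
  have h2 := δ.ev₂_map_tau_tau_comp E (S.free.map (flipB A) ≫ k)
  rw [gen_map_comp] at h2
  refine (congrArg _ ((Category.assoc _ _ _).trans (Category.assoc _ _ _))).trans
    (h1.trans (Eq.trans ?_
      ((congrArg _ ((Category.assoc _ _ _).trans (Category.assoc _ _ _))).trans h2).symm))
  exact lift_comp_flipB _

theorem no_tau [IsAdditive X] (A : X) : δ.tau E A ≫ S.free.map (negB A) =
    E.no (S.free.obj A) δ.tangentNeg ≫ δ.tau E A := by
  refine δ.ev_ext E fun {Y} k => ?_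
  have h1 := δ.ev_tau_comp E (S.free.map (negB A) ≫ k)
  rw [gen_map_comp] at h1
  have h2 := δ.ev_no_comp E (δ.tau E A ≫ k)
  rw [ev_tau_comp] at h2
  refine (congrArg _ (Category.assoc _ _ _)).trans (h1.trans (Eq.trans ?_
    ((congrArg _ (Category.assoc _ _ _)).trans h2).symm))
  exact (lift_comp_negB _).symm

theorem isSum_tau (A : X) : δ.tangent.IsSum (E.tr (δ.tau E A ≫ S.free.map (inj 2 0 A)))
    (E.tr (δ.tau E A ≫ S.free.map (inj 2 1 A))) (E.tr (δ.tau E A ≫ S.free.map (sumB A))) := by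
  refine δ.isSum_of_gen (M := S.free.obj (pow 2 A)) _ _ _ _ _ _ (δ.ev_tau_map E A (inj 2 0 A))
    (δ.ev_tau_map E A (inj 2 1 A)) (δ.ev_tau_map E A (sumB A)) ?_
  have e (j) (k : pow 2 A ⟶ S.obj (pow 2 A)) :
      biprod.inl ≫ inj 2 j A ≫ k = powι 2 A 0 ≫ k := by
    rw [← Category.assoc, inl_inj]
  have e' (j) (k : pow 2 A ⟶ S.obj (pow 2 A)) :
      biprod.inr ≫ inj 2 j A ≫ k = powι 2 A j.succ ≫ k := by
    rw [← Category.assoc, inr_inj]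
  have es (k : pow 2 A ⟶ S.obj (pow 2 A)) : biprod.inl ≫ sumB A ≫ k = powι 2 A 0 ≫ k := by
    rw [← Category.assoc, inl_sumB]
  have es' (k : pow 2 A ⟶ S.obj (pow 2 A)) :
      biprod.inr ≫ sumB A ≫ k = powι 2 A 1 ≫ k + powι 2 A 2 ≫ k := by
    rw [← Category.assoc, inr_sumB, add_comp]
  refine ⟨?_, ?_, ?_⟩
  · exact (biprod.lift_fst _ _).trans ((e 0 _).trans ((e 1 _).symm.trans (biprod.lift_fst _ _).symm))
  · exact (biprod.lift_fst _ _).trans ((e 0 _).trans ((es _).symm.trans (biprod.lift_fst _ _).symm))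
  · refine (biprod.lift_snd _ _).trans ((es' _).trans (congrArg₂ (· + ·) ?_ ?_))
    · exact ((biprod.lift_snd _ _).trans (e' 0 _)).symm
    · exact ((biprod.lift_snd _ _).trans (e' 1 _)).symm

variable (τ : S.free ⋙ E.L ⟶ B X ⋙ S.free) (hτ : ∀ A, τ.app A = δ.tau E A)
include hτ

theorem isTangentMorphism_tauOp (hT : δ.tangent.IsTangent) :
    IsTangentMorphism (biproductDual X) (δ.tangent.dual E) S.free.op (δ.tauOp E τ) := by
  have happ (A : Xᵒᵖ) : (δ.tauOp E τ).app A = (δ.tau E A.unop).op :=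
    congrArg Quiver.Hom.op (hτ A.unop)
  constructor
  · exact isTangent_biproductDual
  · exact E.isTangent_dual hT
  all_goals
    intro A
    simp only [happ]
  · exact Quiver.Hom.unop_inj (δ.po_tau E A.unop)
  · exact Quiver.Hom.unop_inj (δ.tau_zo E A.unop)
  · exact (E.isSum_dual_iff _ _ _).2 (δ.isSum_tau E A.unop)
  · exact Quiver.Hom.unop_inj (δ.lo_tau E A.unop)
  · exact Quiver.Hom.unop_inj (δ.co_tau E A.unop)

/-- The limits are preserved because the opposite of the left adjoint `F` is a right adjoint. -/
theorem isStrongTangentMorphism_tauOp (hT : δ.tangent.IsTangent) :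
    IsStrongTangentMorphism (biproductDual X) (δ.tangent.dual E) S.free.op (δ.tauOp E τ) where
  toIsTangentMorphism := δ.isTangentMorphism_tauOp E τ hτ hT
  isIso := by
    have (A : Xᵒᵖ) : IsIso ((δ.tauOp E τ).app A) := by
      have := δ.isIso_tau E A.unop
      rw [← hτ] at this
      exact inferInstanceAs (IsIso (τ.app A.unop).op)
    exact NatIso.isIso_of_isIso_app _
  pullback n A :=
    have : S.free.op.IsRightAdjoint := S.adj.op.isRightAdjoint
    (isNFoldPullback_biproductDual n A).map S.free.op
  equalizer A := by
    have : S.free.op.IsRightAdjoint := S.adj.op.isRightAdjoint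
    obtain ⟨w, hw, hw'⟩ := universal_biproductDual A
    exact ⟨w, hw, hw'.map S.free.op⟩

theorem isStrongRosickyTangentMorphism_tauOp [IsAdditive X] (hT : δ.tangent.IsRosicky δ.tangentNeg) :
    IsStrongRosickyTangentMorphism (biproductDual X) (biproductDualNeg X) (δ.tangent.dual E)
      (δ.tangent.dualNeg E δ.tangentNeg) S.free.op (δ.tauOp E τ) where
  toIsStrongTangentMorphism := δ.isStrongTangentMorphism_tauOp E τ hτ hT.isTangent
  source_neg := isRosicky_biproductDual
  target_neg := E.isRosicky_dual hT
  n A := by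
    have happ (A : Xᵒᵖ) : (δ.tauOp E τ).app A = (δ.tau E A.unop).op :=
      congrArg Quiver.Hom.op (hτ A.unop)
    rw [happ]
    exact Quiver.Hom.unop_inj (δ.no_tau E A.unop)

theorem isStrongCartesianTangentMorphism_tauOp [HasFiniteCoproducts S.Algebra]
    (hT : δ.tangent.IsTangent) :
    IsStrongCartesianTangentMorphism (biproductDual X) (δ.tangent.dual E) S.free.op
      (δ.tauOp E τ) where
  toIsStrongTangentMorphism := δ.isStrongTangentMorphism_tauOp E τ hτ hT
  source_cartesian := isCartesian_biproductDual
  target_cartesian := E.isCartesian_dual hT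
  preservesFiniteProducts := by
    have : S.free.op.IsRightAdjoint := S.adj.op.isRightAdjoint
    infer_instance

end Tau

end DifferentialCombinator

end CoCartesianDiff

end

/-! ### The main theorem. -/

theorem mainTheorem5 {X : Type u} [Category.{v} X] [HasZeroMorphisms X] [HasFiniteBiproducts X]
    (S : CategoryTheory.Monad X) (δ : CoCartesianDiff.DifferentialCombinator S)
    [HasReflexiveCoequalizers S.Algebra] :
    δ.tangent.HasAdjointTangentStructure ∧
    ∀ E : δ.tangent.Adjoints,
      (δ.tangent.dual E).IsTangent ∧
      ∃ τ : S.free ⋙ E.L ≅ CoCartesianDiff.B X ⋙ S.free,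
        (∀ A, τ.hom.app A = δ.tau E A) ∧
        IsStrongTangentMorphism (CoCartesianDiff.biproductDual X) (δ.tangent.dual E) S.free.op
          (δ.tauOp E τ.hom) ∧
        (∀ [CoCartesianDiff.IsAdditive X],
          δ.tangent.IsRosicky δ.tangentNeg ∧
          (δ.tangent.dual E).IsRosicky (δ.tangent.dualNeg E δ.tangentNeg) ∧
          IsStrongRosickyTangentMorphism
            (CoCartesianDiff.biproductDual X) (CoCartesianDiff.biproductDualNeg X)
            (δ.tangent.dual E) (δ.tangent.dualNeg E δ.tangentNeg) S.free.op
            (δ.tauOp E τ.hom)) ∧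
        (∀ [HasFiniteCoproducts S.Algebra],
          (δ.tangent.dual E).IsCartesian ∧
          IsStrongCartesianTangentMorphism (CoCartesianDiff.biproductDual X) (δ.tangent.dual E)
            S.free.op (δ.tauOp E τ.hom)) := by
  have h1 := δ.isRightAdjoint_tan
  have hT := δ.isTangent_tangent
  refine ⟨⟨hT, h1, δ.isRightAdjoint_tanN⟩, fun E => ⟨E.isTangent_dual hT, δ.tauIso E,
    fun _ => rfl, δ.isStrongTangentMorphism_tauOp E _ (fun _ => rfl) hT, ?_, ?_⟩⟩
  · intro _
    exact ⟨δ.isRosicky_tangent, E.isRosicky_dual δ.isRosicky_tangent,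
      δ.isStrongRosickyTangentMorphism_tauOp E _ (fun _ => rfl) δ.isRosicky_tangent⟩
  · intro _
    exact ⟨E.isCartesian_dual hT,
      δ.isStrongCartesianTangentMorphism_tauOp E _ (fun _ => rfl) hT⟩
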